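/- Let $p>1$, $\lambda>0$ and $n>1$ be real numbers. For $x\in\mathbb R$ put $x^{(p-1)}=|x|^{p-1}\operatorname{sign}(x)$, and let $$\pi_p=\int_{-1}^1\frac{ds}{(1-|s|^p)^{1/p}},\qquad \alpha=\Big(\frac{\lambda}{p-1}\Big)^{1/p}.$$ For $a\ge 0$ and $T(t)=-\frac{n-1}{t}$ or $T\equiv 0$, consider on $[a,\infty)$ the initial value problem $$\frac{d}{dt}\big(\dot w^{(p-1)}\big)=T\,\dot w^{(p-1)}-\lambda\,w^{(p-1)}\ \text{ for } t>a,\qquad w(a)=-1,\quad \dot w(a)=0,$$ where the derivative at $a$ is one-sided, $w\in C^1(a,\infty)$ and $\dot w^{(p-1)}\in C^1(a,\infty)$. For each $a\ge0$, and for either choice of $T$, it has exactly one solution $w=w_a$, and there is a first point $b(a)>a$ with $\dot w(b(a))=0$. Put $\delta(a)=b(a)-a$ and $m(a)=w_a(b(a))$. If $T\equiv0$, then $\delta(a)=\pi_p/\alpha$ for every $a\ge0$. If $T(t)=-\frac{n-1}{t}$, then: 1. $\delta$ is continuous on $[0,\infty)$, $\delta(a)>\pi_p/\alpha$ for every $a\in[0,\infty)$,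 and $\lim_{a\to\infty}\delta(a)=\pi_p/\alpha$; 2. $m(a)<1$ for every $a\in[0,\infty)$, and $\lim_{a\to\infty}m(a)=1$; 3. consequently $\delta$, extended by $\delta(\infty)=\pi_p/\alpha$, is a continuous function $[0,\infty]\to(0,\infty)$. -/

import Mathlib

open scoped ENNReal

noncomputable section

namespace PModel

/-- The signed power `x^{(p-1)} = |x|^{p-1} sign x = |x|^{p-2} x`. -/
def signedPow (p x : ℝ) : ℝ := |x| ^ (p - 1) * Real.sign x

/-- `π_p = ∫_{-1}^{1} ds / (1 - |s|^p)^{1/p}`. -/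
def piP (p : ℝ) : ℝ := ∫ s in (-1 : ℝ)..1, 1 / (1 - |s| ^ p) ^ (1 / p)

/-- `α = (λ / (p-1))^{1/p}`. -/
def alpha (p lam : ℝ) : ℝ := (lam / (p - 1)) ^ (1 / p)

/-- The damping coefficient `T(t) = -(n-1)/t`. -/
def damping (n t : ℝ) : ℝ := -(n - 1) / t

/-- `w` solves, on `[a, ∞)`, the initial value problem
`Δ_p w = T w'^{(p-1)} - λ w^{(p-1)}`, `w(a) = -1`, `w'(a) = 0`, where
`Δ_p w = (p-1) |w'|^{p-2} w''` is understood as the derivative of the flux `w'^{(p-1)}`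
(the usual meaning, as `w` need not be twice differentiable where `w' = 0`).
The derivative at `a` is one-sided.  For `T` continuous on `(a, ∞)` the last field also makes the
flux continuously differentiable there. -/
structure IsSolution (p lam : ℝ) (T : ℝ → ℝ) (a : ℝ) (w : ℝ → ℝ) : Prop where
  init : w a = -1
  init_deriv : HasDerivWithinAt w 0 (Set.Ici a) a
  contDiffOn : ContDiffOn ℝ 1 w (Set.Ioi a)
  ode : ∀ t, a < t → HasDerivAt (fun s => signedPow p (deriv w s))
    (T t * signedPow p (deriv w t) - lam * signedPow p (w t)) t

open scoped Classical in
/-- The solution of the initial value problem starting at `a`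
(only its values on `[a, ∞)` are meaningful; the zero function if there is no solution). -/
def sol (p lam : ℝ) (T : ℝ → ℝ) (a : ℝ) : ℝ → ℝ :=
  if h : ∃ w, IsSolution p lam T a w then h.choose else 0

/-- The critical points of the solution after the initial point. -/
def critAfter (p lam : ℝ) (T : ℝ → ℝ) (a : ℝ) : Set ℝ :=
  {t | a < t ∧ deriv (sol p lam T a) t = 0}

/-- `b(a)`, the first point after `a` at which `w' = 0`. -/
def firstCrit (p lam : ℝ) (T : ℝ → ℝ) (a : ℝ) : ℝ := sInf (critAfter p lam T a)

/-- `δ(a) = b(a) - a`. -/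
def delta (p lam : ℝ) (T : ℝ → ℝ) (a : ℝ) : ℝ := firstCrit p lam T a - a

/-- `m(a) = w(b(a))`. -/
def firstMax (p lam : ℝ) (T : ℝ → ℝ) (a : ℝ) : ℝ := sol p lam T a (firstCrit p lam T a)

open scoped Classical in
/-- `δ` on `[0, ∞]`, with `δ(∞) = π_p / α`. -/
def deltaExt (p lam : ℝ) (T : ℝ → ℝ) (a : ℝ≥0∞) : ℝ :=
  if a = ⊤ then piP p / alpha p lam else delta p lam T a.toReal

/-- For every `a ≥ 0` the initial value problem has exactly one solution on `[a, ∞)`, and its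
derivative has a first zero after `a`; so `b`, `δ` and `m` are well defined on `[0, ∞)`. -/
def WellDefined (p lam : ℝ) (T : ℝ → ℝ) : Prop :=
  ∀ a, 0 ≤ a →
    IsSolution p lam T a (sol p lam T a) ∧
    (∀ v, IsSolution p lam T a v → Set.EqOn v (sol p lam T a) (Set.Ici a)) ∧
    IsLeast (critAfter p lam T a) (firstCrit p lam T a)

end PModel

end

/-!
Generalized polar coordinates `w = R sin_p ϑ`, `w' = α R cos_p ϑ` turn the equation into
`ϑ' = α + (K / t) f(ϑ)` with `K = (n - 1) / (p - 1)` and `f = sin_p · cos_p^{(p-1)}`, together with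
`R' = -(K / t) |cos_p ϑ|^p R`. The solution has its initial minimum at `ϑ = -π_p / 2` and its first
maximum when `ϑ` reaches `π_p / 2`, so `δ(a)` is the time the angle needs to gain `π_p`.

The coefficient `K / t` is singular at `t = 0`, but `f` vanishes at `-π_p / 2` and is antitone near
it. The singular term therefore contracts: the difference of two angles starting at `-π_p / 2`
cannot grow because of it, which gives existence, uniqueness and continuous dependence on `a`
down to `a = 0`. The energy `|w|^p + |w'/α|^p` of a solution never vanishes, so every solution
admits continuous polar coordinates and is determined by its angle.

The primitive of `f` that vanishes at `±π_p / 2` is negative in between. Integrating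
`ϑ' - α = (K / t) f(ϑ)` by parts against it, with `K / t` decreasing, gives `α δ(a) > π_p`; the
bound `|f| ≤ 1` gives `(α - K / a) δ(a) ≤ π_p`. Finally `m(a) = exp (-K ∫ |cos_p ϑ|^p / t)`.
-/

noncomputable section

namespace PModel

open Real Set Filter Topology MeasureTheory
open scoped NNReal

variable {p : ℝ}

/-! ### Signed powers -/

/-- The signed power `x^{(r)} = |x|^r sign x` with exponent `r`. -/
def spow (r x : ℝ) : ℝ := |x| ^ r * Real.sign x

theorem signedPow_eq_spow (p : ℝ) : signedPow p = spow (p - 1) := rfl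

@[simp] theorem spow_zero (r : ℝ) : spow r 0 = 0 := by simp [spow]

theorem spow_of_pos {r x : ℝ} (hx : 0 < x) : spow r x = x ^ r := by
  simp [spow, Real.sign_of_pos hx, abs_of_pos hx]

theorem spow_neg (r x : ℝ) : spow r (-x) = -spow r x := by
  simp [spow, Real.sign_neg]

theorem spow_eq_mul_abs_rpow (r x : ℝ) : spow r x = x * |x| ^ (r - 1) := by
  rcases lt_trichotomy x 0 with h | rfl | h
  · rw [spow, Real.sign_of_neg h, Real.rpow_sub_one (abs_ne_zero.2 h.ne), abs_of_neg h]
    field_simp [h.ne]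
  · simp
  · rw [spow_of_pos h, abs_of_pos h, Real.rpow_sub_one h.ne']
    field_simp

theorem spow_const_mul {c : ℝ} (hc : 0 < c) (r x : ℝ) : spow r (c * x) = c ^ r * spow r x := by
  rw [spow_eq_mul_abs_rpow, spow_eq_mul_abs_rpow, abs_mul, abs_of_pos hc,
    Real.mul_rpow hc.le (abs_nonneg x), Real.rpow_sub_one hc.ne']
  field_simp

@[simp] theorem spow_one (x : ℝ) : spow 1 x = x := by
  simp [spow_eq_mul_abs_rpow]

theorem spow_pos {r x : ℝ} (hx : 0 < x) : 0 < spow r x := by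
  rw [spow_of_pos hx]; positivity

theorem spow_neg_of_neg {r x : ℝ} (hx : x < 0) : spow r x < 0 := by
  simpa [spow_neg] using spow_pos (r := r) (neg_pos.2 hx)

theorem spow_eq_zero {r x : ℝ} : spow r x = 0 ↔ x = 0 := by
  refine ⟨fun h => ?_, fun h => by rw [h, spow_zero]⟩
  rcases lt_trichotomy x 0 with hx | hx | hx
  · exact absurd h (spow_neg_of_neg hx).ne
  · exact hx
  · exact absurd h (spow_pos hx).ne'

theorem sign_spow (r x : ℝ) : Real.sign (spow r x) = Real.sign x := by
  rcases lt_trichotomy x 0 with h | rfl | h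
  · rw [Real.sign_of_neg h, Real.sign_of_neg (spow_neg_of_neg h)]
  · rw [spow_zero]
  · rw [Real.sign_of_pos h, Real.sign_of_pos (spow_pos h)]

theorem abs_spow {r : ℝ} (hr : r ≠ 0) (x : ℝ) : |spow r x| = |x| ^ r := by
  rcases eq_or_ne x 0 with rfl | hx
  · simp [Real.zero_rpow hr]
  · rw [spow_eq_mul_abs_rpow, abs_mul, abs_of_nonneg (by positivity : 0 ≤ |x| ^ (r - 1)),
      Real.rpow_sub_one (abs_ne_zero.2 hx), mul_div_cancel₀ _ (abs_ne_zero.2 hx)]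

theorem abs_spow_le_one {r x : ℝ} (hr : 0 < r) (hx : |x| ≤ 1) : |spow r x| ≤ 1 := by
  rw [abs_spow hr.ne']
  exact Real.rpow_le_one (abs_nonneg x) hx hr.le

theorem spow_spow {s : ℝ} (r : ℝ) (hs : s ≠ 0) (x : ℝ) : spow r (spow s x) = spow (s * r) x := by
  rw [spow, sign_spow, abs_spow hs, ← Real.rpow_mul (abs_nonneg x), spow]

theorem mul_spow {r : ℝ} (hr : r + 1 ≠ 0) (x : ℝ) : x * spow r x = |x| ^ (r + 1) := by
  rcases eq_or_ne x 0 with rfl | hx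
  · simp [Real.zero_rpow hr]
  · have hx' := abs_ne_zero.2 hx
    rw [spow_eq_mul_abs_rpow, Real.rpow_add_one hx', Real.rpow_sub_one hx', ← mul_assoc,
      ← abs_mul_abs_self x]
    field_simp

theorem hasDerivAt_spow {r x : ℝ} (hx : x ≠ 0) : HasDerivAt (spow r) (r * |x| ^ (r - 1)) x := by
  wlog h : 0 < x generalizing x
  · have hneg := this (neg_ne_zero.2 hx) (neg_pos.2 (hx.lt_of_le (not_lt.1 h)))
    simpa [Function.comp_def, spow_neg] using (hneg.comp x (hasDerivAt_neg x)).fun_neg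
  · rw [abs_of_pos h]
    exact (Real.hasDerivAt_rpow_const (Or.inl hx)).congr_of_eventuallyEq
      ((eventually_gt_nhds h).mono fun y hy => spow_of_pos hy)

theorem continuous_spow {r : ℝ} (hr : 0 < r) : Continuous (spow r) := by
  refine continuous_iff_continuousAt.2 fun x => ?_
  rcases eq_or_ne x 0 with rfl | hx
  · rw [ContinuousAt, spow_zero, tendsto_zero_iff_abs_tendsto_zero]
    simpa [Function.comp_def, abs_spow hr.ne', Real.zero_rpow hr.ne'] using
      ((continuous_abs.rpow_const fun _ => Or.inr hr.le).tendsto (0 : ℝ))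
  · exact (hasDerivAt_spow hx).continuousAt

theorem hasDerivAt_abs_rpow_spow {r : ℝ} (hr : 1 < r) (x : ℝ) :
    HasDerivAt (fun y => |y| ^ r) (r * spow (r - 1) x) x := by
  convert hasDerivAt_abs_rpow x hr using 1
  rw [spow_eq_mul_abs_rpow, show r - 1 - 1 = r - 2 by ring]
  ring

/-! ### Generalized trigonometric functions -/

theorem hasDerivAt_of_hasDerivAt_off_countable {E : Type*} [NormedAddCommGroup E]
    [NormedSpace ℝ E] [CompleteSpace E] {f g : ℝ → E} {s : Set ℝ} (hs : s.Countable)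
    (hf : Continuous f) (hg : Continuous g) (h : ∀ x, x ∉ s → HasDerivAt f (g x) x) (x : ℝ) :
    HasDerivAt f (g x) x := by
  have hint : ∀ y, ∫ u in (0 : ℝ)..y, g u = f y - f 0 := fun y =>
    integral_eq_of_hasDerivAt_off_countable f g hs hf.continuousOn
      (fun u hu => h u hu.2) (hg.intervalIntegrable _ _)
  have hprim : f = fun y => f 0 + ∫ u in (0 : ℝ)..y, g u := by
    funext y; rw [hint]; abel
  rw [hprim]
  exact (intervalIntegral.integral_hasDerivAt_right (hg.intervalIntegrable _ _)
    (hg.stronglyMeasurableAtFilter _ _) hg.continuousAt).const_add _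

theorem measurable_tan : Measurable Real.tan := by
  rw [show Real.tan = fun x => Real.sin x / Real.cos x from funext Real.tan_eq_sin_div_cos]
  exact Real.measurable_sin.div Real.measurable_cos

theorem countable_tan_eq_zero : {β : ℝ | tan β = 0}.Countable := by
  rw [show {β : ℝ | tan β = 0} = range fun k : ℤ => (k : ℝ) * π / 2 by
    ext β; simp [Real.tan_eq_zero_iff]]
  exact countable_range _

theorem intervalIntegrable_abs_tan_rpow_zero_pi_div_four {r : ℝ} (hr : -1 < r) :
    IntervalIntegrable (fun x => |tan x| ^ r) volume 0 (π / 4) := by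
  have hbound : IntervalIntegrable (fun x : ℝ => x ^ r + 1) volume 0 (π / 4) :=
    (intervalIntegral.intervalIntegrable_rpow' hr).add intervalIntegrable_const
  refine hbound.mono_fun ((measurable_tan.abs.pow_const r).aestronglyMeasurable) ?_
  rw [Filter.EventuallyLE, ae_restrict_iff' measurableSet_uIoc, uIoc_of_le (by positivity)]
  refine Eventually.of_forall fun x ⟨hx, hx'⟩ => ?_
  have htan : x ≤ tan x := Real.le_tan hx.le (by linarith)
  have htan_pos : 0 < tan x := hx.trans_le htan
  have htan_le_one : tan x ≤ 1 := by
    rw [← Real.tan_pi_div_four]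
    exact Real.strictMonoOn_tan.monotoneOn ⟨by linarith, by linarith⟩
      ⟨by linarith, by linarith⟩ hx'
  rw [abs_of_pos htan_pos, Real.norm_of_nonneg (by positivity), Real.norm_of_nonneg (by positivity)]
  rcases le_total 0 r with h | h
  · exact (Real.rpow_le_one htan_pos.le htan_le_one h).trans
      (le_add_of_nonneg_left (by positivity))
  · exact (Real.rpow_le_rpow_of_nonpos hx htan h).trans (le_add_of_nonneg_right zero_le_one)

theorem intervalIntegrable_abs_tan_rpow {r : ℝ} (hr : -1 < r) (hr' : r < 1) (a b : ℝ) :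
    IntervalIntegrable (fun x => |tan x| ^ r) volume a b := by
  have hcompl : ∀ x, |tan (π / 2 - x)| ^ (-r) = |tan x| ^ r := fun x => by
    rw [Real.tan_pi_div_two_sub, abs_inv, Real.inv_rpow (abs_nonneg _),
      Real.rpow_neg (abs_nonneg _), inv_inv]
  have hupper : IntervalIntegrable (fun x => |tan x| ^ r) volume (π / 4) (π / 2) := by
    have h := (intervalIntegrable_abs_tan_rpow_zero_pi_div_four
      (r := -r) (by linarith)).comp_sub_left (π / 2)
    simp only [hcompl] at h
    convert h.symm using 1 <;> ring
  have hpos := (intervalIntegrable_abs_tan_rpow_zero_pi_div_four hr).trans hupper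
  have hneg : IntervalIntegrable (fun x => |tan x| ^ r) volume (-(π / 2)) 0 := by
    simpa [Real.tan_neg] using (hpos.comp_sub_left 0).symm
  have hper : Function.Periodic (fun x => |tan x| ^ r) π := fun x => by
    simp only [Real.tan_periodic x]
  refine hper.intervalIntegrable (t := -(π / 2)) Real.pi_ne_zero ?_ a b
  convert hneg.trans hpos using 1
  ring

/-- The density `dθ/dβ` of the generalized angle `θ` with respect to the Euclidean angle `β`,
for the parametrization `x = (sin β)^{(2/p)}`, `y = (cos β)^{(2/p)}` of the curve
`|x|^p + |y|^p = 1`: it is the one for which `dx = y dθ`. -/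
def angleDensity (p β : ℝ) : ℝ := 2 / p * |tan β| ^ (2 / p - 1)

theorem intervalIntegrable_angleDensity (hp : 1 < p) (a b : ℝ) :
    IntervalIntegrable (angleDensity p) volume a b := by
  have hlower : 0 < 2 / p := by positivity
  have hupper : 2 / p < 2 := div_lt_self two_pos hp
  exact (intervalIntegrable_abs_tan_rpow (by linarith) (by linarith) a b).const_mul _

theorem angleDensity_pos {β : ℝ} (hp : 0 < p) (h : tan β ≠ 0) : 0 < angleDensity p β := by
  have := abs_pos.2 h
  unfold angleDensity; positivity

theorem angleDensity_nonneg (hp : 0 ≤ p) (β : ℝ) : 0 ≤ angleDensity p β := by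
  unfold angleDensity; positivity

theorem periodic_angleDensity (p : ℝ) : Function.Periodic (angleDensity p) π := fun x => by
  simp only [angleDensity, Real.tan_periodic x]

theorem integral_angleDensity_pos {x y : ℝ} (hp : 1 < p) (hxy : x < y) :
    0 < ∫ t in x..y, angleDensity p t := by
  have hp0 : 0 < p := one_pos.trans hp
  rw [intervalIntegral.integral_pos_iff_support_of_nonneg_ae
    (Eventually.of_forall (angleDensity_nonneg hp0.le)) (intervalIntegrable_angleDensity hp x y)]
  have hsupport : Ioc x y \ {β : ℝ | tan β = 0} ⊆ Function.support (angleDensity p) ∩ Ioc x y :=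
    fun t ht => ⟨(angleDensity_pos hp0 ht.2).ne', ht.1⟩
  refine ⟨hxy, lt_of_lt_of_le ?_ (measure_mono hsupport)⟩
  rw [measure_sdiff_null (countable_tan_eq_zero.measure_zero _)]
  simpa using hxy

/-- The generalized angle `θ` as a function of the Euclidean angle `β`. -/
def genAngle (p β : ℝ) : ℝ := ∫ x in (0 : ℝ)..β, angleDensity p x

@[simp] theorem genAngle_zero (p : ℝ) : genAngle p 0 = 0 := by simp [genAngle]

theorem genAngle_neg (p β : ℝ) : genAngle p (-β) = -genAngle p β := by
  have heven : ∀ x, angleDensity p (-x) = angleDensity p x := fun x => by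
    simp [angleDensity, Real.tan_neg]
  have h := intervalIntegral.integral_comp_neg (a := 0) (b := β) (angleDensity p)
  simp only [heven, neg_zero] at h
  rw [genAngle, genAngle, h, intervalIntegral.integral_symm]

theorem strictMono_genAngle (hp : 1 < p) : StrictMono (genAngle p) := fun x y hxy => by
  rw [← sub_pos, genAngle, genAngle, intervalIntegral.integral_interval_sub_left
    (intervalIntegrable_angleDensity hp 0 y) (intervalIntegrable_angleDensity hp 0 x)]
  exact integral_angleDensity_pos hp hxy

theorem surjective_genAngle (hp : 1 < p) : Function.Surjective (genAngle p) := by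
  have hpos := integral_angleDensity_pos hp Real.pi_pos
  exact (intervalIntegral.continuous_primitive (intervalIntegrable_angleDensity hp) 0).surjective
    ((periodic_angleDensity p).tendsto_atTop_intervalIntegral_of_pos hpos Real.pi_pos)
    ((periodic_angleDensity p).tendsto_atBot_intervalIntegral_of_pos hpos Real.pi_pos)

theorem continuous_genAngle (hp : 1 < p) : Continuous (genAngle p) :=
  (strictMono_genAngle hp).monotone.continuous_of_surjective (surjective_genAngle hp)

theorem hasDerivAt_genAngle {β : ℝ} (hp : 1 < p) (h : tan β ≠ 0) :
    HasDerivAt (genAngle p) (angleDensity p β) β := by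
  have hcos : cos β ≠ 0 := fun hc => h (Real.tan_eq_zero_of_cos_eq_zero hc)
  have hmeas : Measurable (angleDensity p) := (measurable_tan.abs.pow_const _).const_mul _
  exact intervalIntegral.integral_hasDerivAt_right (intervalIntegrable_angleDensity hp 0 β)
    hmeas.stronglyMeasurable.stronglyMeasurableAtFilter
    (((Real.continuousAt_tan.2 hcos).abs.rpow_const (Or.inl (abs_pos.2 h).ne')).const_mul _)

/-- The Euclidean angle `β` as a function of the generalized angle `θ`, the inverse of
`genAngle p` for `1 < p`. -/
def eucAngle (p : ℝ) : ℝ → ℝ := Function.invFun (genAngle p)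

theorem genAngle_eucAngle (hp : 1 < p) (θ : ℝ) : genAngle p (eucAngle p θ) = θ :=
  Function.rightInverse_invFun (surjective_genAngle hp) θ

theorem eucAngle_genAngle (hp : 1 < p) (β : ℝ) : eucAngle p (genAngle p β) = β :=
  Function.leftInverse_invFun (strictMono_genAngle hp).injective β

theorem strictMono_eucAngle (hp : 1 < p) : StrictMono (eucAngle p) := fun x y hxy => by
  rw [← (strictMono_genAngle hp).lt_iff_lt]
  simpa only [genAngle_eucAngle hp] using hxy

theorem continuous_eucAngle (hp : 1 < p) : Continuous (eucAngle p) :=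
  (strictMono_eucAngle hp).monotone.continuous_of_surjective
    (Function.RightInverse.surjective (eucAngle_genAngle hp))

theorem eucAngle_zero (hp : 1 < p) : eucAngle p 0 = 0 := by
  simpa using eucAngle_genAngle hp 0

theorem eucAngle_neg (hp : 1 < p) (θ : ℝ) : eucAngle p (-θ) = -eucAngle p θ := by
  rw [← genAngle_eucAngle hp θ, ← genAngle_neg, eucAngle_genAngle hp, eucAngle_genAngle hp]

theorem hasDerivAt_eucAngle {θ : ℝ} (hp : 1 < p) (h : tan (eucAngle p θ) ≠ 0) :
    HasDerivAt (eucAngle p) (angleDensity p (eucAngle p θ))⁻¹ θ :=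
  (hasDerivAt_genAngle hp h).of_local_left_inverse (continuous_eucAngle hp).continuousAt
    (angleDensity_pos (one_pos.trans hp) h).ne' (Eventually.of_forall (genAngle_eucAngle hp))

theorem countable_tan_eucAngle_eq_zero (hp : 1 < p) : {θ | tan (eucAngle p θ) = 0}.Countable :=
  countable_tan_eq_zero.preimage (strictMono_eucAngle hp).injective

/-- The generalized sine: `pSin' = pCos` and `|pSin|^p + |pCos|^p = 1`. -/
def pSin (p θ : ℝ) : ℝ := spow (2 / p) (sin (eucAngle p θ))

/-- The generalized cosine, the derivative of `pSin`. -/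
def pCos (p θ : ℝ) : ℝ := spow (2 / p) (cos (eucAngle p θ))

/-- The flux `(pCos)^{(p-1)}` of `pSin`. -/
def pFlux (p θ : ℝ) : ℝ := spow (p - 1) (pCos p θ)

theorem pFlux_eq_spow_cos (hp : 0 < p) (θ : ℝ) :
    pFlux p θ = spow (2 - 2 / p) (cos (eucAngle p θ)) := by
  rw [pFlux, pCos, spow_spow _ (by positivity)]
  congr 1; field_simp

theorem spow_pSin (hp : 0 < p) (θ : ℝ) :
    spow (p - 1) (pSin p θ) = spow (2 - 2 / p) (sin (eucAngle p θ)) := by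
  rw [pSin, spow_spow _ (by positivity)]
  congr 1; field_simp

theorem abs_spow_two_div_rpow (hp : 0 < p) (x : ℝ) : |spow (2 / p) x| ^ p = x ^ 2 := by
  rw [abs_spow (by positivity), ← Real.rpow_mul (abs_nonneg _),
    div_mul_cancel₀ _ hp.ne', Real.rpow_two, sq_abs]

theorem abs_pSin_rpow_add_abs_pCos_rpow (hp : 0 < p) (θ : ℝ) :
    |pSin p θ| ^ p + |pCos p θ| ^ p = 1 := by
  rw [pSin, pCos, abs_spow_two_div_rpow hp, abs_spow_two_div_rpow hp, Real.sin_sq_add_cos_sq]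

theorem continuous_pSin (hp : 1 < p) : Continuous (pSin p) :=
  (continuous_spow (by positivity)).comp (Real.continuous_sin.comp (continuous_eucAngle hp))

theorem continuous_pCos (hp : 1 < p) : Continuous (pCos p) :=
  (continuous_spow (by positivity)).comp (Real.continuous_cos.comp (continuous_eucAngle hp))

theorem continuous_pFlux (hp : 1 < p) : Continuous (pFlux p) :=
  (continuous_spow (by linarith)).comp (continuous_pCos hp)

theorem abs_pSin_le_one (hp : 0 < p) (θ : ℝ) : |pSin p θ| ≤ 1 :=
  abs_spow_le_one (by positivity) (Real.abs_sin_le_one _)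

theorem abs_pCos_le_one (hp : 0 < p) (θ : ℝ) : |pCos p θ| ≤ 1 :=
  abs_spow_le_one (by positivity) (Real.abs_cos_le_one _)

theorem abs_pFlux_le_one (hp : 1 < p) (θ : ℝ) : |pFlux p θ| ≤ 1 :=
  abs_spow_le_one (by linarith) (abs_pCos_le_one (by linarith) θ)

theorem hasDerivAt_pSin (hp : 1 < p) (θ : ℝ) : HasDerivAt (pSin p) (pCos p θ) θ := by
  refine hasDerivAt_of_hasDerivAt_off_countable (countable_tan_eucAngle_eq_zero hp)
    (continuous_pSin hp) (continuous_pCos hp) (fun x (hx : tan (eucAngle p x) ≠ 0) => ?_) θ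
  obtain ⟨hs, hc⟩ := div_ne_zero_iff.1 (Real.tan_eq_sin_div_cos _ ▸ hx)
  refine ((hasDerivAt_spow (r := 2 / p) hs).comp x
    ((Real.hasDerivAt_sin _).comp x (hasDerivAt_eucAngle hp hx))).congr_deriv ?_
  have hs' := abs_pos.2 hs
  have hc' := abs_pos.2 hc
  rw [angleDensity, Real.tan_eq_sin_div_cos, abs_div, Real.div_rpow hs'.le hc'.le, pCos,
    spow_eq_mul_abs_rpow]
  field_simp

theorem hasDerivAt_pFlux (hp : 1 < p) (θ : ℝ) :
    HasDerivAt (pFlux p) (-(p - 1) * spow (p - 1) (pSin p θ)) θ := by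
  refine hasDerivAt_of_hasDerivAt_off_countable (countable_tan_eucAngle_eq_zero hp)
    (g := fun θ => -(p - 1) * spow (p - 1) (pSin p θ)) (continuous_pFlux hp)
    (continuous_const.mul ((continuous_spow (by linarith)).comp (continuous_pSin hp)))
    (fun x (hx : tan (eucAngle p x) ≠ 0) => ?_) θ
  obtain ⟨hs, hc⟩ := div_ne_zero_iff.1 (Real.tan_eq_sin_div_cos _ ▸ hx)
  have hp0 : 0 < p := one_pos.trans hp
  rw [funext (pFlux_eq_spow_cos hp0)]
  refine ((hasDerivAt_spow (r := 2 - 2 / p) hc).comp x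
    ((Real.hasDerivAt_cos _).comp x (hasDerivAt_eucAngle hp hx))).congr_deriv ?_
  have hs' := abs_pos.2 hs
  have hc' := abs_pos.2 hc
  rw [angleDensity, Real.tan_eq_sin_div_cos, abs_div, Real.div_rpow hs'.le hc'.le, spow_pSin hp0,
    spow_eq_mul_abs_rpow, show 2 - 2 / p - 1 = -(2 / p - 1) by ring, Real.rpow_neg hs'.le,
    Real.rpow_neg hc'.le]
  field_simp

theorem pCos_mul_pFlux (hp : 0 < p) (θ : ℝ) : pCos p θ * pFlux p θ = |pCos p θ| ^ p := by
  rw [pFlux, mul_spow (by linarith), sub_add_cancel]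

theorem pSin_mul_spow (hp : 0 < p) (θ : ℝ) :
    pSin p θ * spow (p - 1) (pSin p θ) = |pSin p θ| ^ p := by
  rw [mul_spow (by linarith), sub_add_cancel]

/-- A quarter of the period of `pSin`, that is, `π_p / 2`. -/
def quarterPeriod (p : ℝ) : ℝ := genAngle p (π / 2)

theorem quarterPeriod_pos (hp : 1 < p) : 0 < quarterPeriod p := by
  rw [← genAngle_zero p]
  exact strictMono_genAngle hp (by positivity)

theorem eucAngle_quarterPeriod (hp : 1 < p) : eucAngle p (quarterPeriod p) = π / 2 :=
  eucAngle_genAngle hp _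

theorem pSin_neg (hp : 1 < p) (θ : ℝ) : pSin p (-θ) = -pSin p θ := by
  rw [pSin, eucAngle_neg hp, Real.sin_neg, spow_neg, pSin]

theorem pCos_neg (hp : 1 < p) (θ : ℝ) : pCos p (-θ) = pCos p θ := by
  rw [pCos, eucAngle_neg hp, Real.cos_neg, pCos]

theorem pSin_zero (hp : 1 < p) : pSin p 0 = 0 := by
  rw [pSin, eucAngle_zero hp, Real.sin_zero, spow_zero]

theorem pSin_quarterPeriod (hp : 1 < p) : pSin p (quarterPeriod p) = 1 := by
  rw [pSin, eucAngle_quarterPeriod hp, Real.sin_pi_div_two, spow_of_pos one_pos, Real.one_rpow]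

theorem pSin_neg_quarterPeriod (hp : 1 < p) : pSin p (-quarterPeriod p) = -1 := by
  rw [pSin_neg hp, pSin_quarterPeriod hp]

theorem pCos_quarterPeriod (hp : 1 < p) : pCos p (quarterPeriod p) = 0 := by
  rw [pCos, eucAngle_quarterPeriod hp, Real.cos_pi_div_two, spow_zero]

theorem pCos_neg_quarterPeriod (hp : 1 < p) : pCos p (-quarterPeriod p) = 0 := by
  rw [pCos_neg hp, pCos_quarterPeriod hp]

theorem pCos_pos {θ : ℝ} (hp : 1 < p) (h : θ ∈ Ioo (-quarterPeriod p) (quarterPeriod p)) :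
    0 < pCos p θ := by
  refine spow_pos (Real.cos_pos_of_mem_Ioo ⟨?_, ?_⟩) <;>
    rw [← eucAngle_quarterPeriod hp]
  · rw [← eucAngle_neg hp]; exact strictMono_eucAngle hp h.1
  · exact strictMono_eucAngle hp h.2

theorem strictMonoOn_pSin (hp : 1 < p) :
    StrictMonoOn (pSin p) (Icc (-quarterPeriod p) (quarterPeriod p)) := by
  refine strictMonoOn_of_deriv_pos (convex_Icc _ _) (continuous_pSin hp).continuousOn fun x hx => ?_
  rw [interior_Icc] at hx
  exact (hasDerivAt_pSin hp x).deriv ▸ pCos_pos hp hx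

theorem pSin_pos {θ : ℝ} (hp : 1 < p) (h : θ ∈ Ioc 0 (quarterPeriod p)) : 0 < pSin p θ := by
  rw [← pSin_zero hp]
  have := quarterPeriod_pos hp
  exact strictMonoOn_pSin hp ⟨by linarith, this.le⟩ ⟨by linarith [h.1], h.2⟩ h.1

theorem image_pSin_Ioo (hp : 1 < p) :
    pSin p '' Ioo (-quarterPeriod p) (quarterPeriod p) = Ioo (-1) 1 := by
  have hle : -quarterPeriod p ≤ quarterPeriod p := by linarith [quarterPeriod_pos hp]
  rw [← pSin_neg_quarterPeriod hp, ← pSin_quarterPeriod hp]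
  refine Subset.antisymm ?_ (intermediate_value_Ioo hle (continuous_pSin hp).continuousOn)
  rintro _ ⟨x, hx, rfl⟩
  exact ⟨strictMonoOn_pSin hp (left_mem_Icc.2 hle) (Ioo_subset_Icc_self hx) hx.1,
    strictMonoOn_pSin hp (Ioo_subset_Icc_self hx) (right_mem_Icc.2 hle) hx.2⟩

theorem piP_eq_two_mul_quarterPeriod (hp : 1 < p) : piP p = 2 * quarterPeriod p := by
  have hp0 : 0 < p := one_pos.trans hp
  have hle : -quarterPeriod p ≤ quarterPeriod p := by linarith [quarterPeriod_pos hp]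
  have hsubst := integral_image_eq_integral_abs_deriv_smul (f := pSin p) (f' := pCos p)
    measurableSet_Ioo (fun x _ => (hasDerivAt_pSin hp x).hasDerivWithinAt)
    ((strictMonoOn_pSin hp).injOn.mono Ioo_subset_Icc_self)
    (fun s => 1 / (1 - |s| ^ p) ^ (1 / p))
  have hone : ∀ x ∈ Ioo (-quarterPeriod p) (quarterPeriod p),
      |pCos p x| • (1 / (1 - |pSin p x| ^ p) ^ (1 / p)) = 1 := fun x hx => by
    rw [← eq_sub_of_add_eq' (abs_pSin_rpow_add_abs_pCos_rpow hp0 x),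
      ← Real.rpow_mul (abs_nonneg _), mul_one_div_cancel hp0.ne', Real.rpow_one, smul_eq_mul,
      mul_one_div_cancel (abs_pos.2 (pCos_pos hp hx).ne').ne']
  rw [piP, intervalIntegral.integral_of_le (by norm_num), integral_Ioc_eq_integral_Ioo,
    ← image_pSin_Ioo hp, hsubst, setIntegral_congr_fun measurableSet_Ioo hone]
  simp only [integral_const, smul_eq_mul, mul_one, measureReal_restrict_apply_univ,
    Real.volume_real_Ioo_of_le hle]
  ring

theorem piP_pos (hp : 1 < p) : 0 < piP p := by
  rw [piP_eq_two_mul_quarterPeriod hp]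
  exact mul_pos two_pos (quarterPeriod_pos hp)

/-- The nonlinearity `pSin * pFlux` of the equation satisfied by the generalized angle of a
solution. -/
def angleForce (p θ : ℝ) : ℝ := pSin p θ * pFlux p θ

theorem abs_angleForce_le_one (hp : 1 < p) (θ : ℝ) : |angleForce p θ| ≤ 1 := by
  rw [angleForce, abs_mul]
  exact mul_le_one₀ (abs_pSin_le_one (one_pos.trans hp) θ) (abs_nonneg _) (abs_pFlux_le_one hp θ)

theorem hasDerivAt_angleForce (hp : 1 < p) (θ : ℝ) :
    HasDerivAt (angleForce p) (1 - p * |pSin p θ| ^ p) θ := by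
  have hp0 : 0 < p := one_pos.trans hp
  refine ((hasDerivAt_pSin hp θ).mul (hasDerivAt_pFlux hp θ)).congr_deriv ?_
  linear_combination pCos_mul_pFlux hp0 θ - (p - 1) * pSin_mul_spow hp0 θ +
    abs_pSin_rpow_add_abs_pCos_rpow hp0 θ

theorem continuous_angleForce (hp : 1 < p) : Continuous (angleForce p) :=
  (continuous_pSin hp).mul (continuous_pFlux hp)

theorem lipschitzWith_angleForce (hp : 1 < p) : LipschitzWith (Real.toNNReal p) (angleForce p) := by
  refine lipschitzWith_of_nnnorm_deriv_le
    (fun θ => (hasDerivAt_angleForce hp θ).differentiableAt) fun θ => ?_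
  have hnonneg : 0 ≤ |pSin p θ| ^ p := by positivity
  have hle : |pSin p θ| ^ p ≤ 1 :=
    Real.rpow_le_one (abs_nonneg _) (abs_pSin_le_one (by linarith) θ) (by linarith)
  rw [← NNReal.coe_le_coe, coe_nnnorm, (hasDerivAt_angleForce hp θ).deriv,
    Real.coe_toNNReal _ (by linarith), Real.norm_eq_abs, abs_le]
  constructor <;> nlinarith

theorem angleForce_neg (hp : 1 < p) (θ : ℝ) : angleForce p (-θ) = -angleForce p θ := by
  rw [angleForce, pSin_neg hp, pFlux, pCos_neg hp, neg_mul, angleForce, pFlux]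

theorem angleForce_quarterPeriod (hp : 1 < p) : angleForce p (quarterPeriod p) = 0 := by
  rw [angleForce, pFlux, pCos_quarterPeriod hp, spow_zero, mul_zero]

theorem angleForce_neg_quarterPeriod (hp : 1 < p) : angleForce p (-quarterPeriod p) = 0 := by
  rw [angleForce_neg hp, angleForce_quarterPeriod hp, neg_zero]

theorem angleForce_pos {θ : ℝ} (hp : 1 < p) (h : θ ∈ Ioo 0 (quarterPeriod p)) :
    0 < angleForce p θ :=
  mul_pos (pSin_pos hp ⟨h.1, h.2.le⟩) (spow_pos (pCos_pos hp
    ⟨by linarith [h.1, quarterPeriod_pos hp], h.2⟩))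

theorem exists_antitoneOn_angleForce (hp : 1 < p) :
    ∃ ρ > 0, AntitoneOn (angleForce p) (Icc (-quarterPeriod p - ρ) (-quarterPeriod p + ρ)) := by
  have hcont : Continuous fun θ => 1 - p * |pSin p θ| ^ p :=
    continuous_const.sub (continuous_const.mul
      ((continuous_pSin hp).abs.rpow_const fun _ => Or.inr (by linarith)))
  have hneg : 1 - p * |pSin p (-quarterPeriod p)| ^ p < 0 := by
    simp only [pSin_neg_quarterPeriod hp, abs_neg, abs_one, Real.one_rpow]; linarith
  obtain ⟨ρ, hρ, hball⟩ := Metric.nhds_basis_closedBall.eventually_iff.1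
    (hcont.continuousAt.eventually_lt_const hneg)
  rw [Real.closedBall_eq_Icc] at hball
  refine ⟨ρ, hρ, antitoneOn_of_deriv_nonpos (convex_Icc _ _) (continuous_angleForce hp).continuousOn
    (fun x _ => (hasDerivAt_angleForce hp x).differentiableAt.differentiableWithinAt)
    fun x hx => ?_⟩
  exact (hasDerivAt_angleForce hp x).deriv ▸ (hball (interior_subset hx)).le

/-! ### Global existence for ordinary differential equations -/

section GlobalExistence

variable {E : Type*} [NormedAddCommGroup E] [NormedSpace ℝ E] [CompleteSpace E] {v : ℝ → E → E}

theorem exists_forall_mem_Ioo_hasDerivAt {L M : ℝ≥0} {l u t₀ : ℝ} (ht₀ : t₀ ∈ Icc l u)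
    (hlip : ∀ t ∈ Icc l u, LipschitzWith L (v t)) (hcont : ∀ x, ContinuousOn (v · x) (Icc l u))
    (hbound : ∀ t ∈ Icc l u, ∀ x, ‖v t x‖ ≤ M) (y : E) :
    ∃ φ : ℝ → E, φ t₀ = y ∧ ∀ t ∈ Ioo l u, HasDerivAt φ (v t (φ t)) t := by
  have hradius : 0 ≤ M * max (u - t₀) (t₀ - l) :=
    mul_nonneg M.2 (le_max_of_le_left (sub_nonneg.2 ht₀.2))
  have hpl : IsPicardLindelof v (tmin := l) (tmax := u) ⟨t₀, ht₀⟩ y ⟨_, hradius⟩ 0 M L :=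
    ⟨fun t ht => (hlip t ht).lipschitzOnWith, fun x _ => hcont x, fun t ht x _ => hbound t ht x,
      by simp only [NNReal.coe_zero, sub_zero]; exact le_rfl⟩
  obtain ⟨φ, hφ₀, hφ⟩ := hpl.exists_eq_forall_mem_Icc_hasDerivWithinAt₀
  exact ⟨φ, hφ₀, fun t ht => (hφ t ⟨ht.1.le, ht.2.le⟩).hasDerivAt (Icc_mem_nhds ht.1 ht.2)⟩

theorem exists_forall_gt_hasDerivAt {c t₀ : ℝ} (ht₀ : c < t₀)
    (hlip : ∀ l > c, ∃ L : ℝ≥0, ∀ t ≥ l, LipschitzWith L (v t))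
    (hcont : ∀ x, ContinuousOn (v · x) (Ioi c))
    (hbound : ∀ l > c, ∃ M : ℝ≥0, ∀ t ≥ l, ∀ x, ‖v t x‖ ≤ M) (y : E) :
    ∃ φ : ℝ → E, φ t₀ = y ∧ ∀ t > c, HasDerivAt φ (v t (φ t)) t := by
  have hlocal : ∀ t > c, ∃ l u, ∃ φ : ℝ → E, c < l ∧ t ∈ Ioo l u ∧ t₀ ∈ Ioo l u ∧ φ t₀ = y ∧
      ∀ s ∈ Ioo l u, HasDerivAt φ (v s (φ s)) s := fun t ht => by
    obtain ⟨l, hcl, hl⟩ := exists_between (lt_min ht ht₀)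
    obtain ⟨u, hu⟩ := exists_gt (max t t₀)
    rw [lt_min_iff] at hl
    rw [max_lt_iff] at hu
    obtain ⟨L, hL⟩ := hlip l hcl
    obtain ⟨M, hM⟩ := hbound l hcl
    obtain ⟨φ, hφ₀, hφ⟩ := exists_forall_mem_Ioo_hasDerivAt ⟨hl.2.le, hu.2.le⟩
      (fun s hs => hL s hs.1) (fun x => (hcont x).mono fun s hs => hcl.trans_le hs.1)
      (fun s hs => hM s hs.1) y
    exact ⟨l, u, φ, hcl, ⟨hl.1, hu.1⟩, ⟨hl.2, hu.2⟩, hφ₀, hφ⟩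
  choose! l u φ hcl ht ht₀' hφ₀ hφ using hlocal
  have hagree : ∀ s > c, ∀ t > c, s ∈ Ioo (l t) (u t) → φ s s = φ t s := fun s hs t ht' hst => by
    obtain ⟨L, hL⟩ := hlip (max (l s) (l t)) ((hcl s hs).trans_le (le_max_left _ _))
    exact ODE_solution_unique_of_mem_Ioo (v := v) (s := fun _ => univ) (t₀ := t₀)
      (a := max (l s) (l t)) (b := min (u s) (u t))
      (fun r hr => (hL r hr.1.le).lipschitzOnWith)
      ⟨max_lt (ht₀' s hs).1 (ht₀' t ht').1, lt_min (ht₀' s hs).2 (ht₀' t ht').2⟩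
      (fun r hr => ⟨hφ s hs r ⟨(le_max_left _ _).trans_lt hr.1, hr.2.trans_le (min_le_left _ _)⟩,
        mem_univ _⟩)
      (fun r hr => ⟨hφ t ht' r ⟨(le_max_right _ _).trans_lt hr.1,
        hr.2.trans_le (min_le_right _ _)⟩, mem_univ _⟩)
      ((hφ₀ s hs).trans (hφ₀ t ht').symm)
      ⟨max_lt (ht s hs).1 hst.1, lt_min (ht s hs).2 hst.2⟩
  refine ⟨fun t => φ t t, hφ₀ t₀ ht₀, fun t ht' => ?_⟩
  refine (hφ t ht' t (ht t ht')).congr_of_eventuallyEq ?_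
  filter_upwards [Ioo_mem_nhds (ht t ht').1 (ht t ht').2] with s hs
  exact hagree s ((hcl t ht').trans hs.1) t ht' hs

end GlobalExistence

/-! ### The angle equation -/

section AngleEquation

variable {g : ℝ → ℝ} {α K c θ₀ ρ : ℝ} {L : ℝ≥0} {ϑ ϑ₁ ϑ₂ : ℝ → ℝ}

/-- The right-hand side `α + (K / t) g(θ)` of the angle equation with force `g`. -/
def angleField (g : ℝ → ℝ) (α K t θ : ℝ) : ℝ := α + K / t * g θ

/-- `ϑ` solves the angle equation `ϑ' = α + (K / t) g(ϑ)` on `(c, ∞)`. -/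
def IsAngle (g : ℝ → ℝ) (α K c : ℝ) (ϑ : ℝ → ℝ) : Prop :=
  ∀ t, c < t → HasDerivAt ϑ (angleField g α K t (ϑ t)) t

theorem IsAngle.mono {d : ℝ} (h : IsAngle g α K c ϑ) (hcd : c ≤ d) : IsAngle g α K d ϑ :=
  fun t ht => h t (hcd.trans_lt ht)

theorem IsAngle.continuousOn (h : IsAngle g α K c ϑ) : ContinuousOn ϑ (Ioi c) :=
  fun t ht => (h t ht).continuousAt.continuousWithinAt

theorem abs_angleField_sub_le {s t : ℝ} (hg : LipschitzWith L g) (hK : 0 ≤ K) (hs : 0 < s)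
    (hst : s ≤ t) (x y : ℝ) :
    |angleField g α K t x - angleField g α K t y| ≤ K * L / s * |x - y| := by
  have hKt : 0 ≤ K / t := div_nonneg hK (hs.le.trans hst)
  calc |angleField g α K t x - angleField g α K t y| = K / t * |g x - g y| := by
        rw [angleField, angleField, add_sub_add_left_eq_sub, ← mul_sub, abs_mul, abs_of_nonneg hKt]
    _ ≤ K / t * (L * |x - y|) := by gcongr; exact hg.dist_le_mul x y
    _ ≤ K / s * (L * |x - y|) := by gcongr
    _ = K * L / s * |x - y| := by ring

theorem lipschitzWith_angleField {s t : ℝ} (hg : LipschitzWith L g) (hK : 0 ≤ K) (hs : 0 < s)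
    (hst : s ≤ t) : LipschitzWith (Real.toNNReal (K * L / s)) (angleField g α K t) := by
  refine LipschitzWith.of_dist_le_mul fun x y => ?_
  rw [Real.coe_toNNReal _ (by positivity)]
  exact abs_angleField_sub_le hg hK hs hst x y

theorem abs_angleField_le {s t : ℝ} (hg : ∀ θ, |g θ| ≤ 1) (hK : 0 ≤ K) (hs : 0 < s)
    (hst : s ≤ t) (x : ℝ) : |angleField g α K t x| ≤ |α| + K / s := by
  have hKt : 0 ≤ K / t := div_nonneg hK (hs.le.trans hst)
  calc |angleField g α K t x| ≤ |α| + |K / t * g x| := abs_add_le _ _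
    _ = |α| + K / t * |g x| := by rw [abs_mul, abs_of_nonneg hKt]
    _ ≤ |α| + K / t * 1 := by gcongr; exact hg x
    _ ≤ |α| + K / s := by rw [mul_one]; gcongr

theorem exists_isAngle {t₀ : ℝ} (hg : LipschitzWith L g) (hg1 : ∀ θ, |g θ| ≤ 1) (hK : 0 ≤ K)
    (ht₀ : 0 < t₀) (y : ℝ) : ∃ ϑ : ℝ → ℝ, ϑ t₀ = y ∧ IsAngle g α K 0 ϑ := by
  refine exists_forall_gt_hasDerivAt ht₀
    (fun l hl => ⟨_, fun t ht => lipschitzWith_angleField hg hK hl ht⟩) (fun x => ?_)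
    (fun l hl => ⟨⟨|α| + K / l, by positivity⟩, fun t ht x => abs_angleField_le hg1 hK hl ht x⟩) y
  exact continuousOn_const.add ((continuousOn_const.div continuousOn_id
    fun t (ht : 0 < t) => ht.ne').mul continuousOn_const)

theorem IsAngle.dist_le {s t : ℝ} (hg : LipschitzWith L g) (hK : 0 ≤ K) (h₁ : IsAngle g α K c ϑ₁)
    (h₂ : IsAngle g α K c ϑ₂) (hs0 : 0 < s) (hs : c < s) (hst : s ≤ t) :
    |ϑ₁ t - ϑ₂ t| ≤ |ϑ₁ s - ϑ₂ s| * exp (K * L / s * (t - s)) := by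
  have h := dist_le_of_trajectories_ODE_of_mem (v := angleField g α K) (s := fun _ => univ)
    (a := s) (b := t) (fun r hr => (lipschitzWith_angleField hg hK hs0 hr.1).lipschitzOnWith)
    (h₁.continuousOn.mono fun r hr => hs.trans_le hr.1)
    (fun r hr => (h₁ r (hs.trans_le hr.1)).hasDerivWithinAt) (fun _ _ => mem_univ _)
    (h₂.continuousOn.mono fun r hr => hs.trans_le hr.1)
    (fun r hr => (h₂ r (hs.trans_le hr.1)).hasDerivWithinAt) (fun _ _ => mem_univ _) le_rfl
    t ⟨hst, le_rfl⟩
  rwa [Real.coe_toNNReal _ (by positivity), Real.dist_eq, Real.dist_eq] at h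

theorem IsAngle.dist_le_of_antitoneOn {s t : ℝ} {u : Set ℝ} (hK : 0 ≤ K) (hs0 : 0 ≤ s)
    (hu : AntitoneOn g u) (h₁ : IsAngle g α K c ϑ₁) (h₂ : IsAngle g α K c ϑ₂) (hs : c < s)
    (hst : s ≤ t) (hu₁ : ∀ r ∈ Icc s t, ϑ₁ r ∈ u) (hu₂ : ∀ r ∈ Icc s t, ϑ₂ r ∈ u) :
    |ϑ₁ t - ϑ₂ t| ≤ |ϑ₁ s - ϑ₂ s| := by
  have hderiv : ∀ r, c < r → HasDerivAt (fun r => (ϑ₁ r - ϑ₂ r) ^ 2)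
      (2 * (K / r) * ((ϑ₁ r - ϑ₂ r) * (g (ϑ₁ r) - g (ϑ₂ r)))) r := fun r hr => by
    refine (((h₁ r hr).sub (h₂ r hr)).fun_pow 2).congr_deriv ?_
    simp only [angleField, Pi.sub_apply]; push_cast; ring
  have hprod : ∀ r ∈ Icc s t, (ϑ₁ r - ϑ₂ r) * (g (ϑ₁ r) - g (ϑ₂ r)) ≤ 0 := fun r hr => by
    rcases le_total (ϑ₁ r) (ϑ₂ r) with h | h
    · exact mul_nonpos_of_nonpos_of_nonneg (sub_nonpos.2 h)
        (sub_nonneg.2 (hu (hu₁ r hr) (hu₂ r hr) h))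
    · exact mul_nonpos_of_nonneg_of_nonpos (sub_nonneg.2 h)
        (sub_nonpos.2 (hu (hu₂ r hr) (hu₁ r hr) h))
  have hanti : AntitoneOn (fun r => (ϑ₁ r - ϑ₂ r) ^ 2) (Icc s t) := by
    refine antitoneOn_of_deriv_nonpos (convex_Icc _ _)
      (fun r hr => (hderiv r (hs.trans_le hr.1)).continuousAt.continuousWithinAt)
      (fun r hr => (hderiv r (hs.trans_le (interior_subset hr).1)).differentiableAt
        |>.differentiableWithinAt) (fun r hr => ?_)
    have hr := interior_subset hr
    rw [(hderiv r (hs.trans_le hr.1)).deriv]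
    exact mul_nonpos_of_nonneg_of_nonpos
      (mul_nonneg two_pos.le (div_nonneg hK (hs0.trans hr.1))) (hprod r hr)
  exact sq_le_sq.1 (hanti (left_mem_Icc.2 hst) (right_mem_Icc.2 hst) hst)

/-- Uniqueness from time `0` onwards is not covered by Gronwall's inequality, as `K / t` is not
integrable there; it holds because the force is nonincreasing near `θ₀`. -/
theorem IsAngle.eqOn_of_tendsto {u : Set ℝ} (hg : LipschitzWith L g) (hu : AntitoneOn g u)
    (huθ₀ : u ∈ 𝓝 θ₀) (hK : 0 ≤ K) (hc : 0 ≤ c) (h₁ : IsAngle g α K c ϑ₁)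
    (h₂ : IsAngle g α K c ϑ₂) (hlim₁ : Tendsto ϑ₁ (𝓝[>] c) (𝓝 θ₀))
    (hlim₂ : Tendsto ϑ₂ (𝓝[>] c) (𝓝 θ₀)) : EqOn ϑ₁ ϑ₂ (Ioi c) := by
  obtain ⟨d, hcd : c < d, hd⟩ := mem_nhdsGT_iff_exists_Ioo_subset.1
    ((hlim₁.eventually huθ₀).and (hlim₂.eventually huθ₀))
  have hdist : Tendsto (fun s => |ϑ₁ s - ϑ₂ s|) (𝓝[>] c) (𝓝 0) := by
    simpa using (hlim₁.sub hlim₂).abs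
  have hnear : ∀ t ∈ Ioo c d, |ϑ₁ t - ϑ₂ t| = 0 := fun t ht => by
    refine le_antisymm (ge_of_tendsto hdist ?_) (abs_nonneg _)
    filter_upwards [Ioo_mem_nhdsGT ht.1] with s hs
    exact h₁.dist_le_of_antitoneOn hK (hc.trans hs.1.le) hu h₂ hs.1 hs.2.le
      (fun r hr => (hd ⟨hs.1.trans_le hr.1, hr.2.trans_lt ht.2⟩).1)
      (fun r hr => (hd ⟨hs.1.trans_le hr.1, hr.2.trans_lt ht.2⟩).2)
  intro t (ht : c < t)
  obtain ⟨s, hcs, hs⟩ := exists_between (lt_min ht hcd)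
  rw [lt_min_iff] at hs
  have h := h₁.dist_le hg hK h₂ (hc.trans_lt hcs) hcs hs.1.le
  rw [hnear s ⟨hcs, hs.2⟩, zero_mul] at h
  exact sub_eq_zero.1 (abs_eq_zero.1 (le_antisymm h (abs_nonneg _)))

theorem IsAngle.lt_of_le {s t y : ℝ} (hα : 0 < α) (hy : g y = 0) (h : IsAngle g α K c ϑ)
    (hs : c < s) (hst : s < t) (hys : y ≤ ϑ s) : y < ϑ t := by
  have hfield : ∀ r, ϑ r = y → angleField g α K r (ϑ r) = α := fun r hr => by
    rw [hr, angleField, hy, mul_zero, add_zero]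
  have hle : ∀ r ≥ s, y ≤ ϑ r := fun r hr => by
    refine image_le_of_deriv_right_lt_deriv_boundary' (f := fun _ => y) (f' := fun _ => 0)
      (B := ϑ) (B' := fun r => angleField g α K r (ϑ r)) continuousOn_const
      (fun x _ => hasDerivWithinAt_const _ _ _) hys
      (h.continuousOn.mono fun r hr => hs.trans_le hr.1)
      (fun x hx => (h x (hs.trans_le hx.1)).hasDerivWithinAt) (fun x _ hxy => ?_) ⟨hr, le_rfl⟩
    exact hα.trans_eq (hfield x hxy.symm).symm
  refine (hle t hst.le).lt_of_ne fun heq => hα.ne' ?_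
  have hmin : IsLocalMin ϑ t := by
    filter_upwards [eventually_gt_nhds hst] with r hr using heq ▸ hle r hr.le
  rw [← hfield t heq.symm]
  exact hmin.hasDerivAt_eq_zero (h t (hs.trans hst))

theorem IsAngle.le_add_of_nonpos {a t : ℝ} (hα : 0 < α) (hK : 0 ≤ K)
    (hg : ∀ θ ∈ Icc θ₀ (θ₀ + ρ), g θ ≤ 0) (ha : 0 < a) (h : IsAngle g α K 0 ϑ) (hinit : ϑ a = θ₀)
    (hat : a ≤ t) (ht : 2 * α * (t - a) ≤ ρ) : ϑ t ≤ θ₀ + 2 * α * (t - a) := by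
  refine image_le_of_deriv_right_lt_deriv_boundary (f := ϑ)
    (f' := fun r => angleField g α K r (ϑ r)) (B := fun r => θ₀ + 2 * α * (r - a))
    (B' := fun _ => 2 * α) (a := a) (b := t) (h.continuousOn.mono fun r hr => ha.trans_le hr.1)
    (fun x hx => (h x (ha.trans_le hx.1)).hasDerivWithinAt) (by simp [hinit])
    (fun x => ?_) (fun x hx hxe => ?_) ⟨hat, le_rfl⟩
  · simpa using (((hasDerivAt_id x).sub_const a).const_mul (2 * α)).const_add θ₀
  · have hforce : g (ϑ x) ≤ 0 := hg _ (by rw [hxe]; constructor <;> nlinarith [hx.1, hx.2])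
    have hKx : 0 ≤ K / x := div_nonneg hK (ha.le.trans hx.1)
    simp only [angleField]
    nlinarith

/-- `ϑ` solves the angle equation and takes the value `θ₀` at time `a ≥ 0`. The bounds on `ϑ`, for
`t = a` the initial condition, follow from it when `a > 0` and `g` is nonpositive on
`[θ₀, θ₀ + ρ]`; at `a = 0` they also control how `ϑ` leaves the singular time. -/
structure IsStart (g : ℝ → ℝ) (α K θ₀ ρ a : ℝ) (ϑ : ℝ → ℝ) : Prop where
  isAngle : IsAngle g α K 0 ϑ
  mem_Icc : ∀ t, a ≤ t → 2 * α * (t - a) ≤ ρ → ϑ t ∈ Icc θ₀ (θ₀ + 2 * α * (t - a))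

theorem IsStart.init {a : ℝ} (hρ : 0 ≤ ρ) (h : IsStart g α K θ₀ ρ a ϑ) : ϑ a = θ₀ := by
  simpa using h.mem_Icc a le_rfl (by simpa using hρ)

theorem IsStart.gt {a t : ℝ} (hα : 0 < α) (hρ : 0 < ρ) (hθ₀ : g θ₀ = 0) (ha : 0 ≤ a)
    (h : IsStart g α K θ₀ ρ a ϑ) (ht : a < t) : θ₀ < ϑ t := by
  have hlt : a < a + ρ / (2 * α) := lt_add_of_pos_right a (by positivity)
  obtain ⟨s, has, hs⟩ := exists_between (lt_min ht hlt)
  rw [lt_min_iff, ← sub_lt_iff_lt_add', lt_div_iff₀' (by positivity)] at hs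
  exact h.isAngle.lt_of_le hα hθ₀ (ha.trans_lt has) hs.1 (h.mem_Icc s has.le hs.2.le).1

theorem IsStart.eventually_mem_Icc {a : ℝ} (hα : 0 < α) (hρ : 0 < ρ)
    (h : IsStart g α K θ₀ ρ a ϑ) : ∀ᶠ t in 𝓝[>] a, ϑ t ∈ Icc θ₀ (θ₀ + 2 * α * (t - a)) := by
  have hlt : a < a + ρ / (2 * α) := lt_add_of_pos_right a (by positivity)
  filter_upwards [Ioo_mem_nhdsGT hlt] with t ht
  have hle := ht.2
  rw [← sub_lt_iff_lt_add', lt_div_iff₀' (by positivity)] at hle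
  exact h.mem_Icc t ht.1.le hle.le

theorem tendsto_const_mul_sub_nhdsGT (k a : ℝ) :
    Tendsto (fun t => k * (t - a)) (𝓝[>] a) (𝓝 0) := by
  have hcont : Continuous fun t : ℝ => k * (t - a) := by fun_prop
  simpa using (hcont.tendsto a).mono_left nhdsWithin_le_nhds

theorem IsStart.tendsto {a : ℝ} (hα : 0 < α) (hρ : 0 < ρ) (h : IsStart g α K θ₀ ρ a ϑ) :
    Tendsto ϑ (𝓝[>] a) (𝓝 θ₀) := by
  refine tendsto_of_tendsto_of_tendsto_of_le_of_le' tendsto_const_nhds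
    (by simpa using (tendsto_const_mul_sub_nhdsGT (2 * α) a).const_add θ₀)
    ((h.eventually_mem_Icc hα hρ).mono fun t ht => ht.1)
    ((h.eventually_mem_Icc hα hρ).mono fun t ht => ht.2)

theorem exists_isStart_of_pos {a : ℝ} (hg : LipschitzWith L g) (hg1 : ∀ θ, |g θ| ≤ 1)
    (hθ₀ : g θ₀ = 0) (hanti : AntitoneOn g (Icc θ₀ (θ₀ + ρ))) (hα : 0 < α) (hK : 0 ≤ K)
    (ha : 0 < a) : ∃ ϑ, IsStart g α K θ₀ ρ a ϑ := by
  obtain ⟨ϑ, hinit, h⟩ := exists_isAngle hg hg1 hK ha θ₀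
  have hnonpos : ∀ θ ∈ Icc θ₀ (θ₀ + ρ), g θ ≤ 0 := fun θ hθ =>
    hθ₀ ▸ hanti (left_mem_Icc.2 (hθ.1.trans hθ.2)) hθ hθ.1
  refine ⟨ϑ, h, fun t hat ht => ⟨?_, h.le_add_of_nonpos hα hK hnonpos ha hinit hat ht⟩⟩
  rcases hat.eq_or_lt with rfl | hat
  · exact hinit.ge
  · exact (h.lt_of_le hα hθ₀ ha hat hinit.ge).le

theorem IsStart.abs_sub_le_of_mul_le {a₁ a₂ s t : ℝ} (hanti : AntitoneOn g (Icc θ₀ (θ₀ + ρ)))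
    (hα : 0 < α) (hK : 0 ≤ K) (ha₁ : 0 ≤ a₁) (ha₂ : 0 ≤ a₂) (h₁ : IsStart g α K θ₀ ρ a₁ ϑ₁)
    (h₂ : IsStart g α K θ₀ ρ a₂ ϑ₂) (has₁ : a₁ ≤ s) (has₂ : a₂ ≤ s) (hs : 0 < s) (hst : s ≤ t)
    (ht : 2 * α * t ≤ ρ) : |ϑ₁ t - ϑ₂ t| ≤ 2 * α * s := by
  have hbound : ∀ a ϑ, 0 ≤ a → a ≤ s → IsStart g α K θ₀ ρ a ϑ → ∀ r ∈ Icc s t,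
      ϑ r ∈ Icc θ₀ (θ₀ + 2 * α * r) := fun a ϑ ha has h r hr => by
    have hra : 2 * α * (r - a) ≤ 2 * α * r := by gcongr; exact sub_le_self r ha
    have hrt : 2 * α * r ≤ 2 * α * t := by gcongr; exact hr.2
    have hmem := h.mem_Icc r (has.trans hr.1) (hra.trans (hrt.trans ht))
    exact ⟨hmem.1, hmem.2.trans (by gcongr)⟩
  have hmem : ∀ a ϑ, 0 ≤ a → a ≤ s → IsStart g α K θ₀ ρ a ϑ → ∀ r ∈ Icc s t,
      ϑ r ∈ Icc θ₀ (θ₀ + ρ) := fun a ϑ ha has h r hr =>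
    Icc_subset_Icc_right (by nlinarith [hr.2]) (hbound a ϑ ha has h r hr)
  have hs₁ := hbound a₁ ϑ₁ ha₁ has₁ h₁ s ⟨le_rfl, hst⟩
  have hs₂ := hbound a₂ ϑ₂ ha₂ has₂ h₂ s ⟨le_rfl, hst⟩
  refine (h₁.isAngle.dist_le_of_antitoneOn hK hs.le hanti h₂.isAngle hs hst
    (hmem a₁ ϑ₁ ha₁ has₁ h₁) (hmem a₂ ϑ₂ ha₂ has₂ h₂)).trans ?_
  exact abs_le.2 ⟨by linarith [hs₁.1, hs₂.2], by linarith [hs₁.2, hs₂.1]⟩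

theorem IsStart.abs_sub_le {a₁ a₂ s t : ℝ} (hg : LipschitzWith L g)
    (hanti : AntitoneOn g (Icc θ₀ (θ₀ + ρ))) (hα : 0 < α) (hK : 0 ≤ K) (ha₁ : 0 ≤ a₁)
    (ha₂ : 0 ≤ a₂) (h₁ : IsStart g α K θ₀ ρ a₁ ϑ₁) (h₂ : IsStart g α K θ₀ ρ a₂ ϑ₂) (has₁ : a₁ ≤ s)
    (has₂ : a₂ ≤ s) (hs : 0 < s) (hsρ : 2 * α * s ≤ ρ) (hst : s ≤ t) :
    |ϑ₁ t - ϑ₂ t| ≤ 2 * α * s * exp (K * L / (ρ / (2 * α)) * t) := by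
  have hρ : 0 < ρ := lt_of_lt_of_le (by positivity) hsρ
  set τ := ρ / (2 * α)
  have hτ : 0 < τ := by positivity
  have hτρ : 2 * α * τ = ρ := mul_div_cancel₀ ρ (by positivity)
  have hsτ : s ≤ τ := (le_div_iff₀' (by positivity)).2 hsρ
  have hsmall : ∀ r, s ≤ r → r ≤ τ → |ϑ₁ r - ϑ₂ r| ≤ 2 * α * s := fun r hsr hr =>
    h₁.abs_sub_le_of_mul_le hanti hα hK ha₁ ha₂ h₂ has₁ has₂ hs hsr
      (hτρ ▸ by gcongr)
  have ht : 0 < t := hs.trans_le hst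
  rcases le_total t τ with htτ | htτ
  · exact (hsmall t hst htτ).trans
      (le_mul_of_one_le_right (by positivity) (Real.one_le_exp (by positivity)))
  · refine (h₁.isAngle.dist_le hg hK h₂.isAngle hτ hτ htτ).trans ?_
    gcongr
    · exact hsmall τ hsτ le_rfl
    · exact sub_le_self t hτ.le

theorem isAngle_of_tendstoUniformlyOn {φ : ℕ → ℝ → ℝ} (hg : LipschitzWith L g) (hK : 0 ≤ K)
    (hφ : ∀ k, IsAngle g α K 0 (φ k))
    (hlim : ∀ l u, 0 < l → TendstoUniformlyOn φ ϑ atTop (Ioo l u)) : IsAngle g α K 0 ϑ := by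
  intro t (ht : 0 < t)
  have hfield : TendstoUniformlyOn (fun k s => angleField g α K s (φ k s))
      (fun s => angleField g α K s (ϑ s)) atTop (Ioo (t / 2) (2 * t)) := by
    rw [Metric.tendstoUniformlyOn_iff]
    intro e he
    obtain ⟨d, hd, hde⟩ := exists_pos_mul_lt he (K * L / (t / 2))
    filter_upwards [Metric.tendstoUniformlyOn_iff.1 (hlim (t / 2) (2 * t) (by positivity)) d hd]
      with k hk s hs
    calc |angleField g α K s (ϑ s) - angleField g α K s (φ k s)|
        ≤ K * L / (t / 2) * |ϑ s - φ k s| := abs_angleField_sub_le hg hK (by positivity) hs.1.le _ _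
      _ ≤ K * L / (t / 2) * d := by gcongr; exact (hk s hs).le
      _ < e := hde
  have hmem : t ∈ Ioo (t / 2) (2 * t) := ⟨by linarith, by linarith⟩
  exact hasDerivAt_of_tendstoUniformlyOn isOpen_Ioo hfield
    (Eventually.of_forall fun k s hs => hφ k s ((half_pos ht).trans hs.1))
    (fun s hs => (hlim (t / 2) (2 * t) (half_pos ht)).tendsto_at hs) hmem

theorem exists_abs_sub_le_of_isStart {φ : ℕ → ℝ → ℝ} {ε : ℕ → ℝ} (hg : LipschitzWith L g)
    (hanti : AntitoneOn g (Icc θ₀ (θ₀ + ρ))) (hα : 0 < α) (hρ : 0 < ρ) (hK : 0 ≤ K)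
    (hε : ∀ k, 0 < ε k) (hε_anti : Antitone ε) (hε_lim : Tendsto ε atTop (𝓝 0))
    (hφ : ∀ k, IsStart g α K θ₀ ρ (ε k) (φ k)) :
    ∃ ψ : ℝ → ℝ, ψ 0 = θ₀ ∧ ∀ k t, 2 * α * ε k ≤ ρ → ε k ≤ t →
      |φ k t - ψ t| ≤ 2 * α * ε k * exp (K * L / (ρ / (2 * α)) * t) := by
  set E : ℝ → ℝ := fun t => exp (K * L / (ρ / (2 * α)) * t)
  have hclose : ∀ t i j, i ≤ j → 2 * α * ε i ≤ ρ → ε i ≤ t →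
      |φ i t - φ j t| ≤ 2 * α * ε i * E t := fun t i j hij hi hit =>
    (hφ i).abs_sub_le hg hanti hα hK (hε i).le (hε j).le (hφ j) le_rfl (hε_anti hij) (hε i) hi hit
  have hsmall : Tendsto (fun k => 2 * α * ε k) atTop (𝓝 0) := by
    simpa using hε_lim.const_mul (2 * α)
  have hcauchy : ∀ t, 0 < t → ∃ l, Tendsto (fun k => φ k t) atTop (𝓝 l) := fun t ht => by
    refine cauchySeq_tendsto_of_complete (Metric.cauchySeq_iff'.2 fun e he => ?_)
    have hrate : Tendsto (fun k => 2 * α * ε k * E t) atTop (𝓝 0) := by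
      simpa using hsmall.mul_const (E t)
    obtain ⟨N, hNρ, hNt, hNe⟩ := ((hsmall.eventually_lt_const hρ).and
      ((hε_lim.eventually_lt_const ht).and (hrate.eventually_lt_const he))).exists
    refine ⟨N, fun n hn => ?_⟩
    rw [dist_comm, Real.dist_eq]
    exact (hclose t N n hn hNρ.le hNt.le).trans_lt hNe
  choose! ψ hψ using hcauchy
  refine ⟨Function.update ψ 0 θ₀, Function.update_self .., fun k t hk hkt => ?_⟩
  have ht : 0 < t := (hε k).trans_le hkt
  rw [Function.update_of_ne ht.ne']
  refine le_of_tendsto ((hψ t ht).const_sub (φ k t)).abs ?_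
  filter_upwards [eventually_ge_atTop k] with j hj using hclose t k j hj hk hkt

theorem exists_isStart_zero (hg : LipschitzWith L g) (hg1 : ∀ θ, |g θ| ≤ 1) (hθ₀ : g θ₀ = 0)
    (hanti : AntitoneOn g (Icc θ₀ (θ₀ + ρ))) (hα : 0 < α) (hρ : 0 < ρ) (hK : 0 ≤ K) :
    ∃ ϑ, IsStart g α K θ₀ ρ 0 ϑ := by
  set ε : ℕ → ℝ := fun k => 1 / ((k : ℝ) + 1)
  have hε : ∀ k, 0 < ε k := fun k => by positivity
  have hε_lim : Tendsto ε atTop (𝓝 0) := tendsto_one_div_add_atTop_nhds_zero_nat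
  choose φ hφ using fun k => exists_isStart_of_pos hg hg1 hθ₀ hanti hα hK (hε k)
  obtain ⟨ψ, hψ₀, hψ⟩ := exists_abs_sub_le_of_isStart hg hanti hα hρ hK hε
    (fun i j hij => Nat.one_div_le_one_div hij) hε_lim hφ
  have hsmall : ∀ t > 0, ∀ᶠ k in atTop, 2 * α * ε k ≤ ρ ∧ ε k ≤ t := fun t ht => by
    filter_upwards [hε_lim.eventually_lt_const (by positivity : 0 < ρ / (2 * α)),
      hε_lim.eventually_lt_const ht] with k hkρ hkt
    exact ⟨(le_div_iff₀' (by positivity)).1 hkρ.le, hkt.le⟩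
  have hunif : ∀ l u, 0 < l → TendstoUniformlyOn φ ψ atTop (Ioo l u) := fun l u hl => by
    have hrate : Tendsto (fun k => 2 * α * ε k * exp (K * L / (ρ / (2 * α)) * u)) atTop (𝓝 0) := by
      simpa using (hε_lim.const_mul (2 * α)).mul_const (exp (K * L / (ρ / (2 * α)) * u))
    rw [Metric.tendstoUniformlyOn_iff]
    intro e he
    filter_upwards [hsmall l hl, hrate.eventually_lt_const he] with k hk hke t ht
    rw [dist_comm, Real.dist_eq]
    refine (hψ k t hk.1 (hk.2.trans ht.1.le)).trans_lt (lt_of_le_of_lt ?_ hke)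
    have := hε k
    gcongr
    exact ht.2.le
  refine ⟨ψ, isAngle_of_tendstoUniformlyOn hg hK (fun k => (hφ k).isAngle) hunif,
    fun t ht htρ => ?_⟩
  rcases ht.eq_or_lt with rfl | ht
  · simp [hψ₀]
  refine isClosed_Icc.mem_of_tendsto
    ((hunif (t / 2) (2 * t) (half_pos ht)).tendsto_at ⟨by linarith, by linarith⟩) ?_
  filter_upwards [hsmall t ht] with k hk
  have hle : 2 * α * (t - ε k) ≤ 2 * α * (t - 0) := by gcongr; exact (hε k).le
  exact Icc_subset_Icc_right (by gcongr) ((hφ k).mem_Icc t hk.2 (hle.trans htρ))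

theorem exists_isStart {a : ℝ} (hg : LipschitzWith L g) (hg1 : ∀ θ, |g θ| ≤ 1) (hθ₀ : g θ₀ = 0)
    (hanti : AntitoneOn g (Icc θ₀ (θ₀ + ρ))) (hα : 0 < α) (hρ : 0 < ρ) (hK : 0 ≤ K)
    (ha : 0 ≤ a) : ∃ ϑ, IsStart g α K θ₀ ρ a ϑ := by
  rcases ha.eq_or_lt with rfl | ha
  · exact exists_isStart_zero hg hg1 hθ₀ hanti hα hρ hK
  · exact exists_isStart_of_pos hg hg1 hθ₀ hanti hα hK ha

theorem tendsto_isStart_zero {t : ℝ} {Θ : ℝ → ℝ → ℝ} (hg : LipschitzWith L g)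
    (hanti : AntitoneOn g (Icc θ₀ (θ₀ + ρ))) (hα : 0 < α) (hρ : 0 < ρ) (hK : 0 ≤ K)
    (hΘ : ∀ a, 0 ≤ a → IsStart g α K θ₀ ρ a (Θ a)) (ht : 0 < t) :
    Tendsto (fun a => Θ a t) (𝓝[≥] 0) (𝓝 (Θ 0 t)) := by
  rw [tendsto_iff_dist_tendsto_zero]
  have hlim : Tendsto (fun a : ℝ => 2 * α * a * exp (K * L / (ρ / (2 * α)) * t))
      (𝓝[≥] 0) (𝓝 0) := by
    have hcont : Continuous fun a : ℝ => 2 * α * a * exp (K * L / (ρ / (2 * α)) * t) := by fun_prop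
    simpa using (hcont.tendsto 0).mono_left nhdsWithin_le_nhds
  refine squeeze_zero' (Eventually.of_forall fun _ => dist_nonneg) ?_ hlim
  have hτ : 0 < ρ / (2 * α) := by positivity
  filter_upwards [Ico_mem_nhdsGE (lt_min hτ ht)] with a ha
  rcases ha.1.eq_or_lt with rfl | ha0
  · simp
  · have ha' := lt_min_iff.1 ha.2
    exact (hΘ a ha0.le).abs_sub_le hg hanti hα hK ha0.le le_rfl (hΘ 0 le_rfl) le_rfl ha0.le ha0
      ((le_div_iff₀' (by positivity)).1 ha'.1.le) ha'.2.le

theorem tendsto_isStart_of_pos {a₀ t : ℝ} {Θ : ℝ → ℝ → ℝ} (hg : LipschitzWith L g) (hρ : 0 ≤ ρ)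
    (hK : 0 ≤ K) (hΘ : ∀ a, 0 ≤ a → IsStart g α K θ₀ ρ a (Θ a)) (ha₀ : 0 < a₀) (ht : a₀ < t) :
    Tendsto (fun a => Θ a t) (𝓝 a₀) (𝓝 (Θ a₀ t)) := by
  have h₀ := hΘ a₀ ha₀.le
  rw [tendsto_iff_dist_tendsto_zero]
  have hlim : Tendsto (fun a => |θ₀ - Θ a₀ a| * exp (K * L / (a₀ / 2) * t)) (𝓝 a₀) (𝓝 0) := by
    have hcont : Tendsto (Θ a₀) (𝓝 a₀) (𝓝 θ₀) := by
      simpa only [h₀.init hρ] using (h₀.isAngle a₀ ha₀).continuousAt.tendsto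
    simpa using (hcont.const_sub θ₀).abs.mul_const (exp (K * L / (a₀ / 2) * t))
  refine squeeze_zero' (Eventually.of_forall fun _ => dist_nonneg) ?_ hlim
  filter_upwards [Ioo_mem_nhds (half_lt_self ha₀) ht] with a ha
  have ha0 : 0 < a := (half_pos ha₀).trans ha.1
  have h := hΘ a ha0.le
  refine (h.isAngle.dist_le hg hK h₀.isAngle ha0 ha0 ha.2.le).trans ?_
  rw [h.init hρ]
  gcongr
  · exact sub_nonneg.2 ha.2.le
  · exact ha.1.le
  · exact sub_le_self t ha0.le

theorem tendsto_isStart {a₀ t : ℝ} {Θ : ℝ → ℝ → ℝ} (hg : LipschitzWith L g)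
    (hanti : AntitoneOn g (Icc θ₀ (θ₀ + ρ))) (hα : 0 < α) (hρ : 0 < ρ) (hK : 0 ≤ K)
    (hΘ : ∀ a, 0 ≤ a → IsStart g α K θ₀ ρ a (Θ a)) (ha₀ : 0 ≤ a₀) (ht : a₀ < t) :
    Tendsto (fun a => Θ a t) (𝓝[Ici 0] a₀) (𝓝 (Θ a₀ t)) := by
  rcases ha₀.eq_or_lt with rfl | ha₀
  · exact tendsto_isStart_zero hg hanti hα hρ hK hΘ ht
  · exact (tendsto_isStart_of_pos hg hρ.le hK hΘ ha₀ ht).mono_left nhdsWithin_le_nhds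

/-! ### The time at which the angle reaches a given value -/

theorem IsAngle.mul_sub_le {s t : ℝ} (hg1 : ∀ θ, |g θ| ≤ 1) (hK : 0 ≤ K) (h : IsAngle g α K c ϑ)
    (hs0 : 0 < s) (hs : c < s) (hst : s ≤ t) : (α - K / s) * (t - s) ≤ ϑ t - ϑ s := by
  refine Convex.mul_sub_le_image_sub_of_le_deriv (convex_Icc s t)
    (h.continuousOn.mono fun r hr => hs.trans_le hr.1) (fun r hr => ?_) (fun r hr => ?_)
    s ⟨le_rfl, hst⟩ t ⟨hst, le_rfl⟩ hst
  all_goals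
    have hsr : s ≤ r := (interior_subset hr).1
    have hr := h r (hs.trans_le hsr)
  · exact hr.differentiableAt.differentiableWithinAt
  · have hforce : -1 ≤ g (ϑ r) := neg_le_of_abs_le (hg1 _)
    have hKr : 0 ≤ K / r := div_nonneg hK (hs0.le.trans hsr)
    have hKs : K / r ≤ K / s := by gcongr
    rw [hr.deriv, angleField]
    nlinarith

theorem IsAngle.tendsto_atTop (hg1 : ∀ θ, |g θ| ≤ 1) (hα : 0 < α) (hK : 0 ≤ K)
    (h : IsAngle g α K c ϑ) : Tendsto ϑ atTop atTop := by
  obtain ⟨s, hs⟩ := exists_gt (max c (K / α))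
  obtain ⟨hcs, hKs⟩ := max_lt_iff.1 hs
  have hs0 : 0 < s := (div_nonneg hK hα.le).trans_lt hKs
  have hslope : 0 < α - K / s := sub_pos.2 ((div_lt_comm₀ hα hs0).1 hKs)
  refine tendsto_atTop_mono' atTop (f₁ := fun t => ϑ s + (α - K / s) * (t - s)) ?_
    (tendsto_atTop_add_const_left _ _
      ((tendsto_atTop_add_const_right _ (-s) tendsto_id).const_mul_atTop hslope))
  filter_upwards [eventually_ge_atTop s] with t ht
  linarith [h.mul_sub_le hg1 hK hs0 hcs ht]

/-- `b` is the only time after `a` at which the angle `ϑ` takes the value `θ₁`, and `ϑ` passes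
`θ₁` from below. -/
structure IsHit (θ₁ a b : ℝ) (ϑ : ℝ → ℝ) : Prop where
  lt : a < b
  eq : ϑ b = θ₁
  before : ∀ t, a < t → t < b → ϑ t < θ₁
  after : ∀ t, b < t → θ₁ < ϑ t

theorem exists_isHit {a θ₁ : ℝ} (hg1 : ∀ θ, |g θ| ≤ 1) (hθ₁ : g θ₁ = 0) (hα : 0 < α) (hK : 0 ≤ K)
    (h : IsAngle g α K a ϑ) (hlim : Tendsto ϑ (𝓝[>] a) (𝓝 θ₀)) (hlt : θ₀ < θ₁) :
    ∃ b, IsHit θ₁ a b ϑ := by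
  obtain ⟨s, hsθ₁, has⟩ := ((hlim.eventually_lt_const hlt).and self_mem_nhdsWithin).exists
  obtain ⟨u, hu, hsu⟩ := (((h.tendsto_atTop hg1 hα hK).eventually_ge_atTop θ₁).and
    (eventually_ge_atTop s)).exists
  obtain ⟨b, hb, hbθ₁⟩ := intermediate_value_Icc hsu
    (h.continuousOn.mono fun t ht => has.trans_le ht.1) ⟨hsθ₁.le, hu⟩
  have hab : a < b := has.trans_le hb.1
  exact ⟨b, hab, hbθ₁, fun t hat htb => not_le.1 fun hθ₁t =>
    (h.lt_of_le hα hθ₁ hat htb hθ₁t).ne' hbθ₁, fun t hbt => h.lt_of_le hα hθ₁ hab hbt hbθ₁.ge⟩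

theorem abs_le_mul_sq_of_hasDerivAt {G : ℝ → ℝ} (hg : LipschitzWith L g) (hθ₀ : g θ₀ = 0)
    (hG : ∀ θ, HasDerivAt G (g θ) θ) (hG₀ : G θ₀ = 0) (θ : ℝ) : |G θ| ≤ L * (θ - θ₀) ^ 2 := by
  have hderiv : ∀ x ∈ uIcc θ₀ θ, ‖g x‖ ≤ L * |θ - θ₀| := fun x hx => by
    have hle : |g x - g θ₀| ≤ L * |x - θ₀| := hg.dist_le_mul x θ₀
    rw [hθ₀, sub_zero] at hle
    exact hle.trans (by gcongr 1; exact abs_sub_left_of_mem_uIcc hx)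
  have hmean := (convex_uIcc θ₀ θ).norm_image_sub_le_of_norm_hasDerivWithin_le
    (fun x _ => (hG x).hasDerivWithinAt) hderiv left_mem_uIcc right_mem_uIcc
  rwa [hG₀, sub_zero, Real.norm_eq_abs, Real.norm_eq_abs, mul_assoc, abs_mul_abs_self,
    ← pow_two] at hmean

theorem IsStart.tendsto_primitive_div {G : ℝ → ℝ} {a : ℝ} (hg : LipschitzWith L g)
    (hθ₀ : g θ₀ = 0) (hG : ∀ θ, HasDerivAt G (g θ) θ) (hG₀ : G θ₀ = 0) (hα : 0 < α) (hρ : 0 < ρ)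
    (ha : 0 ≤ a) (h : IsStart g α K θ₀ ρ a ϑ) :
    Tendsto (fun t => G (ϑ t) / t) (𝓝[>] a) (𝓝 0) := by
  refine squeeze_zero_norm' ?_ (tendsto_const_mul_sub_nhdsGT (4 * L * α ^ 2) a)
  filter_upwards [h.eventually_mem_Icc hα hρ, self_mem_nhdsWithin] with t hϑ (hat : a < t)
  have ht : 0 < t := ha.trans_lt hat
  rw [norm_div, Real.norm_of_nonneg ht.le, div_le_iff₀ ht]
  calc |G (ϑ t)| ≤ L * (ϑ t - θ₀) ^ 2 := abs_le_mul_sq_of_hasDerivAt hg hθ₀ hG hG₀ _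
    _ ≤ L * (2 * α * (t - a)) ^ 2 := by
      gcongr
      · exact sub_nonneg.2 hϑ.1
      · exact sub_le_iff_le_add'.2 hϑ.2
    _ = 4 * L * α ^ 2 * (t - a) * (t - a) := by ring
    _ ≤ 4 * L * α ^ 2 * (t - a) * t := by gcongr; exact sub_le_self t ha

/-- `α t - ϑ` increases by `α (b - a) - (θ₁ - θ₀)` and has derivative `-(K / t) g(ϑ)` of no definite
sign. Integrating by parts with `G` replaces this by a positive derivative; the boundary terms
vanish as `G` vanishes at `θ₀` (to second order) and at `θ₁`. -/
theorem IsHit.sub_lt_mul_sub {G : ℝ → ℝ} {a b θ₁ : ℝ} (hg : LipschitzWith L g) (hθ₀ : g θ₀ = 0)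
    (hG : ∀ θ, HasDerivAt G (g θ) θ) (hG₀ : G θ₀ = 0) (hG₁ : G θ₁ = 0)
    (hGneg : ∀ θ ∈ Ioo θ₀ θ₁, G θ < 0) (hα : 0 < α) (hρ : 0 < ρ) (hK : 0 < K) (ha : 0 ≤ a)
    (h : IsStart g α K θ₀ ρ a ϑ) (hb : IsHit θ₁ a b ϑ) : θ₁ - θ₀ < α * (b - a) := by
  set Φ : ℝ → ℝ := fun t => α * t - ϑ t + K / α * (G (ϑ t) / t) with hΦ
  have hderiv : ∀ t, a < t → HasDerivAt Φ (K / α * ((K * g (ϑ t) ^ 2 - G (ϑ t)) / t ^ 2)) t := by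
    intro t hat
    have ht : 0 < t := ha.trans_lt hat
    have hϑ := h.isAngle t ht
    have hquot := ((hG (ϑ t)).comp t hϑ).div (hasDerivAt_id t) ht.ne'
    refine ((((hasDerivAt_id t).const_mul α).sub hϑ).add (hquot.const_mul (K / α))).congr_deriv ?_
    simp only [angleField, id, Function.comp_apply]
    field_simp
    ring
  have hmono : StrictMonoOn Φ (Ioc a b) := by
    refine strictMonoOn_of_deriv_pos (convex_Ioc _ _)
      (fun t ht => (hderiv t ht.1).continuousAt.continuousWithinAt) fun t ht => ?_
    rw [interior_Ioc] at ht
    have ht0 : 0 < t := ha.trans_lt ht.1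
    have hGt := hGneg (ϑ t) ⟨h.gt hα hρ hθ₀ ha ht.1, hb.before t ht.1 ht.2⟩
    have hnum : 0 < K * g (ϑ t) ^ 2 - G (ϑ t) := sub_pos.2 (hGt.trans_le (by positivity))
    rw [(hderiv t ht.1).deriv]
    positivity
  have hlim : Tendsto Φ (𝓝[>] a) (𝓝 (α * a - θ₀)) := by
    have hlin : Tendsto (fun t : ℝ => α * t) (𝓝[>] a) (𝓝 (α * a)) :=
      ((continuous_const_mul α).tendsto a).mono_left nhdsWithin_le_nhds
    simpa using (hlin.sub (h.tendsto hα hρ)).add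
      ((h.tendsto_primitive_div hg hθ₀ hG hG₀ hα hρ ha).const_mul (K / α))
  obtain ⟨m, ham, hmb⟩ := exists_between hb.lt
  have hΦm : α * a - θ₀ ≤ Φ m := by
    refine le_of_tendsto hlim ?_
    filter_upwards [Ioo_mem_nhdsGT ham] with t ht
    exact (hmono ⟨ht.1, (ht.2.trans hmb).le⟩ ⟨ham, hmb.le⟩ ht.2).le
  have hΦb : Φ b = α * b - θ₁ := by simp only [hΦ, hb.eq, hG₁, zero_div, mul_zero, add_zero]
  linarith [hmono ⟨ham, hmb.le⟩ ⟨hb.lt, le_rfl⟩ hmb]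

theorem eq_of_hasDerivAt_zero_of_tendsto {f : ℝ → ℝ} {a l t : ℝ}
    (hf : ∀ t, a < t → HasDerivAt f 0 t) (hl : Tendsto f (𝓝[>] a) (𝓝 l)) (ht : a < t) :
    f t = l := by
  refine tendsto_nhds_unique (tendsto_const_nhds.congr' ?_) hl
  filter_upwards [self_mem_nhdsWithin] with s hs
  exact isOpen_Ioi.is_const_of_deriv_eq_zero isPreconnected_Ioi
    (fun r hr => (hf r hr).differentiableAt.differentiableWithinAt) (fun r hr => (hf r hr).deriv)
    ht hs

theorem IsHit.mul_sub_eq {a b θ₁ : ℝ} (hα : 0 < α) (hρ : 0 < ρ) (ha : 0 ≤ a)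
    (h : IsStart g α 0 θ₀ ρ a ϑ) (hb : IsHit θ₁ a b ϑ) : α * (b - a) = θ₁ - θ₀ := by
  have hlim : Tendsto (fun t => ϑ t - α * t) (𝓝[>] a) (𝓝 (θ₀ - α * a)) :=
    (h.tendsto hα hρ).sub (((continuous_const_mul α).tendsto a).mono_left nhdsWithin_le_nhds)
  have hconst := eq_of_hasDerivAt_zero_of_tendsto (fun t ht => ?_) hlim hb.lt
  · rw [hb.eq] at hconst
    linarith
  · refine ((h.isAngle t (ha.trans_lt ht)).sub ((hasDerivAt_id t).const_mul α)).congr_deriv ?_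
    simp [angleField]

theorem continuousOn_hit {θ₁ : ℝ} {Θ : ℝ → ℝ → ℝ} {b : ℝ → ℝ} (hg : LipschitzWith L g)
    (hanti : AntitoneOn g (Icc θ₀ (θ₀ + ρ))) (hα : 0 < α) (hρ : 0 < ρ) (hK : 0 ≤ K)
    (hΘ : ∀ a, 0 ≤ a → IsStart g α K θ₀ ρ a (Θ a)) (hb : ∀ a, 0 ≤ a → IsHit θ₁ a (b a) (Θ a)) :
    ContinuousOn b (Ici 0) := by
  intro a₀ (ha₀ : 0 ≤ a₀)
  have h₀ := hb a₀ ha₀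
  refine tendsto_order.2 ⟨fun l hl => ?_, fun u hu => ?_⟩
  · obtain ⟨t, hlt, htb⟩ := exists_between (max_lt hl h₀.lt)
    obtain ⟨hlt, hat⟩ := max_lt_iff.1 hlt
    filter_upwards [(tendsto_isStart hg hanti hα hρ hK hΘ ha₀ hat).eventually_lt_const
      (h₀.before t hat htb), self_mem_nhdsWithin] with a hat₁ ha
    exact hlt.trans_le (not_lt.1 fun hbt => lt_asymm ((hb a ha).after t hbt) hat₁)
  · obtain ⟨t, hbt, htu⟩ := exists_between hu
    have hat : a₀ < t := h₀.lt.trans hbt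
    filter_upwards [(tendsto_isStart hg hanti hα hρ hK hΘ ha₀ hat).eventually_const_lt
      (h₀.after t hbt), self_mem_nhdsWithin, mem_nhdsWithin_of_mem_nhds (Iio_mem_nhds hat)]
      with a hat₁ ha hat'
    exact (not_lt.1 fun htb => lt_asymm ((hb a ha).before t hat' htb) hat₁).trans_lt htu

end AngleEquation

section ForcePrimitive

/-- The primitive of the force vanishing at `-π_p/2`. -/
def forcePrimitive (p θ : ℝ) : ℝ := ∫ x in (-quarterPeriod p)..θ, angleForce p x

theorem hasDerivAt_forcePrimitive (hp : 1 < p) (θ : ℝ) :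
    HasDerivAt (forcePrimitive p) (angleForce p θ) θ :=
  intervalIntegral.integral_hasDerivAt_right ((continuous_angleForce hp).intervalIntegrable _ _)
    ((continuous_angleForce hp).stronglyMeasurableAtFilter _ _)
    (continuous_angleForce hp).continuousAt

theorem forcePrimitive_neg_quarterPeriod (p : ℝ) : forcePrimitive p (-quarterPeriod p) = 0 :=
  intervalIntegral.integral_same

theorem forcePrimitive_neg (hp : 1 < p) (θ : ℝ) : forcePrimitive p (-θ) = forcePrimitive p θ := by
  have hint : ∀ a b, IntervalIntegrable (angleForce p) volume a b :=
    fun a b => (continuous_angleForce hp).intervalIntegrable a b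
  have hodd : ∫ x in (-θ)..θ, angleForce p x = 0 := by
    have h := intervalIntegral.integral_comp_neg (a := -θ) (b := θ) (angleForce p)
    simp only [angleForce_neg hp, intervalIntegral.integral_neg, neg_neg] at h
    linarith
  simpa [forcePrimitive, hodd] using intervalIntegral.integral_add_adjacent_intervals
    (hint (-quarterPeriod p) (-θ)) (hint (-θ) θ)

theorem forcePrimitive_quarterPeriod (hp : 1 < p) : forcePrimitive p (quarterPeriod p) = 0 := by
  rw [← forcePrimitive_neg hp, forcePrimitive_neg_quarterPeriod]

theorem forcePrimitive_neg_of_mem {θ : ℝ} (hp : 1 < p)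
    (hθ : θ ∈ Ioo (-quarterPeriod p) (quarterPeriod p)) : forcePrimitive p θ < 0 := by
  have hanti : StrictAntiOn (forcePrimitive p) (Icc (-quarterPeriod p) 0) := by
    refine strictAntiOn_of_deriv_neg (convex_Icc _ _)
      (fun x _ => (hasDerivAt_forcePrimitive hp x).continuousAt.continuousWithinAt) fun x hx => ?_
    rw [interior_Icc] at hx
    have hpos := angleForce_pos hp (θ := -x) ⟨neg_pos.2 hx.2, neg_lt.1 hx.1⟩
    rw [angleForce_neg hp, neg_pos] at hpos
    rwa [(hasDerivAt_forcePrimitive hp x).deriv]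
  wlog hθ0 : θ ≤ 0 generalizing θ
  · rw [← forcePrimitive_neg hp]
    exact this ⟨neg_lt_neg hθ.2, neg_lt.1 hθ.1⟩ (by linarith)
  rw [← forcePrimitive_neg_quarterPeriod p]
  exact hanti ⟨le_rfl, hθ.1.le.trans hθ0⟩ ⟨hθ.1.le, hθ0⟩ hθ.1

end ForcePrimitive

/-! ### The wave of an angle -/

section Wave

variable {α K ρ a t : ℝ} {ϑ : ℝ → ℝ}

/-- The logarithmic decay rate, up to the factor `-K`, of the amplitude of the wave with
angle `ϑ`. -/
def decayRate (p : ℝ) (ϑ : ℝ → ℝ) (t : ℝ) : ℝ := |pCos p (ϑ t)| ^ p / t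

theorem abs_pCos_rpow_le_one (hp : 0 < p) (θ : ℝ) : |pCos p θ| ^ p ≤ 1 :=
  Real.rpow_le_one (abs_nonneg _) (abs_pCos_le_one hp θ) hp.le

theorem abs_pFlux_le_mul_abs_add (hp : 1 < p) (θ : ℝ) :
    |pFlux p θ| ≤ (p - 1) * |θ + quarterPeriod p| := by
  have hderiv : ∀ x, ‖-(p - 1) * spow (p - 1) (pSin p x)‖ ≤ p - 1 := fun x => by
    have hspow := abs_spow_le_one (sub_pos.2 hp) (abs_pSin_le_one (one_pos.trans hp) x)
    rw [norm_mul, norm_neg, Real.norm_of_nonneg (sub_pos.2 hp).le]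
    exact mul_le_of_le_one_right (sub_pos.2 hp).le hspow
  have hmean := convex_univ.norm_image_sub_le_of_norm_hasDerivWithin_le
    (fun x _ => (hasDerivAt_pFlux hp x).hasDerivWithinAt) (fun x _ => hderiv x)
    (mem_univ (-quarterPeriod p)) (mem_univ θ)
  rwa [pFlux, pFlux, pCos_neg_quarterPeriod hp, spow_zero, sub_zero, sub_neg_eq_add] at hmean

theorem abs_pCos_rpow_le (hp : 1 < p) (θ : ℝ) :
    |pCos p θ| ^ p ≤ (p - 1) * |θ + quarterPeriod p| := by
  have hp0 : 0 < p := one_pos.trans hp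
  calc |pCos p θ| ^ p = |pCos p θ| * |pFlux p θ| := by
        rw [← abs_mul, pCos_mul_pFlux hp0, Real.abs_rpow_of_nonneg (abs_nonneg _), abs_abs]
    _ ≤ |pFlux p θ| := mul_le_of_le_one_left (abs_nonneg _) (abs_pCos_le_one hp0 θ)
    _ ≤ (p - 1) * |θ + quarterPeriod p| := abs_pFlux_le_mul_abs_add hp θ

theorem decayRate_nonneg (p : ℝ) (ϑ : ℝ → ℝ) (ht : 0 ≤ t) : 0 ≤ decayRate p ϑ t := by
  unfold decayRate; positivity

theorem continuousOn_decayRate (hp : 1 < p) (ha : 0 ≤ a) (hϑ : ContinuousOn ϑ (Ioi a)) :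
    ContinuousOn (decayRate p ϑ) (Ioi a) :=
  (((continuous_pCos hp).comp_continuousOn hϑ).abs.rpow_const
    fun _ _ => Or.inr (one_pos.trans hp).le).div continuousOn_id
    fun _ ht => (ha.trans_lt ht).ne'

theorem exists_decayRate_le (hp : 1 < p) (hα : 0 < α) (hρ : 0 < ρ) (ha : 0 ≤ a)
    (h : IsStart (angleForce p) α K (-quarterPeriod p) ρ a ϑ) :
    ∃ M, ∀ t, a < t → |decayRate p ϑ t| ≤ M := by
  refine ⟨max ((p - 1) * (2 * α)) (2 * α / ρ), fun t hat => ?_⟩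
  have ht : 0 < t := ha.trans_lt hat
  rw [abs_of_nonneg (decayRate_nonneg p ϑ ht.le), decayRate, div_le_iff₀ ht]
  rcases le_total (2 * α * (t - a)) ρ with hnear | hfar
  · have hϑ := h.mem_Icc t hat.le hnear
    calc |pCos p (ϑ t)| ^ p ≤ (p - 1) * |ϑ t + quarterPeriod p| := abs_pCos_rpow_le hp _
      _ ≤ (p - 1) * (2 * α * t) := by
        have hat' : 2 * α * (t - a) ≤ 2 * α * t := by gcongr; exact sub_le_self t ha
        rw [abs_of_nonneg (by linarith [hϑ.1])]
        gcongr
        linarith [hϑ.2]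
      _ = (p - 1) * (2 * α) * t := by ring
      _ ≤ _ := by gcongr; exact le_max_left _ _
  · calc |pCos p (ϑ t)| ^ p ≤ 1 := abs_pCos_rpow_le_one (one_pos.trans hp) _
      _ ≤ 2 * α / ρ * t := by
        rw [div_mul_eq_mul_div, one_le_div hρ]
        exact hfar.trans (by gcongr; exact sub_le_self t ha)
      _ ≤ _ := by gcongr; exact le_max_right _ _

theorem intervalIntegrable_decayRate (hp : 1 < p) (hα : 0 < α) (hρ : 0 < ρ) (ha : 0 ≤ a)
    (h : IsStart (angleForce p) α K (-quarterPeriod p) ρ a ϑ) (hat : a ≤ t) :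
    IntervalIntegrable (decayRate p ϑ) volume a t := by
  obtain ⟨M, hM⟩ := exists_decayRate_le hp hα hρ ha h
  have hcont := continuousOn_decayRate hp ha (h.isAngle.mono ha).continuousOn
  rw [intervalIntegrable_iff_integrableOn_Ioc_of_le hat]
  exact .of_bound measure_Ioc_lt_top
    ((hcont.mono Ioc_subset_Ioi_self).aestronglyMeasurable measurableSet_Ioc) M
    ((ae_restrict_iff' measurableSet_Ioc).2 (.of_forall fun s hs => hM s hs.1))

/-- The amplitude of the wave with angle `ϑ`, normalized to be `1` at `a`. -/
def amplitude (p K a : ℝ) (ϑ : ℝ → ℝ) (t : ℝ) : ℝ := exp (-K * ∫ s in a..t, decayRate p ϑ s)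

theorem amplitude_pos (p K a : ℝ) (ϑ : ℝ → ℝ) (t : ℝ) : 0 < amplitude p K a ϑ t := exp_pos _

theorem amplitude_self (p K a : ℝ) (ϑ : ℝ → ℝ) : amplitude p K a ϑ a = 1 := by
  simp [amplitude]

theorem hasDerivAt_amplitude (hp : 1 < p) (hα : 0 < α) (hρ : 0 < ρ) (ha : 0 ≤ a)
    (h : IsStart (angleForce p) α K (-quarterPeriod p) ρ a ϑ) (hat : a < t) :
    HasDerivAt (amplitude p K a ϑ) (-K * decayRate p ϑ t * amplitude p K a ϑ t) t := by
  have hcont := continuousOn_decayRate hp ha (h.isAngle.mono ha).continuousOn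
  have hint : HasDerivAt (fun u => ∫ s in a..u, decayRate p ϑ s) (decayRate p ϑ t) t :=
    intervalIntegral.integral_hasDerivAt_right
      (intervalIntegrable_decayRate hp hα hρ ha h hat.le)
      (hcont.stronglyMeasurableAtFilter isOpen_Ioi t hat) (hcont.continuousAt (Ioi_mem_nhds hat))
  exact (hint.const_mul (-K)).exp.congr_deriv (mul_comm _ _)

theorem tendsto_amplitude (hp : 1 < p) (hα : 0 < α) (hρ : 0 < ρ) (ha : 0 ≤ a)
    (h : IsStart (angleForce p) α K (-quarterPeriod p) ρ a ϑ) :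
    Tendsto (amplitude p K a ϑ) (𝓝[>] a) (𝓝 1) := by
  obtain ⟨M, hM⟩ := exists_decayRate_le hp hα hρ ha h
  have hint : Tendsto (fun t => ∫ s in a..t, decayRate p ϑ s) (𝓝[>] a) (𝓝 0) := by
    refine squeeze_zero_norm' ?_ (tendsto_const_mul_sub_nhdsGT M a)
    filter_upwards [self_mem_nhdsWithin] with t (hat : a < t)
    rw [← abs_of_pos (sub_pos.2 hat)]
    refine intervalIntegral.norm_integral_le_of_norm_le_const fun s hs => ?_
    rw [uIoc_of_le hat.le] at hs
    exact hM s hs.1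
  have hexp := (hint.const_mul (-K)).rexp
  rwa [mul_zero, exp_zero] at hexp

/-- The solution of the initial value problem with angle `ϑ`. -/
def wave (p K a : ℝ) (ϑ : ℝ → ℝ) (t : ℝ) : ℝ := amplitude p K a ϑ t * pSin p (ϑ t)

theorem hasDerivAt_wave (hp : 1 < p) (hα : 0 < α) (hρ : 0 < ρ) (ha : 0 ≤ a)
    (h : IsStart (angleForce p) α K (-quarterPeriod p) ρ a ϑ) (hat : a < t) :
    HasDerivAt (wave p K a ϑ) (α * amplitude p K a ϑ t * pCos p (ϑ t)) t := by
  refine ((hasDerivAt_amplitude hp hα hρ ha h hat).mul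
    ((hasDerivAt_pSin hp (ϑ t)).comp t (h.isAngle t (ha.trans_lt hat)))).congr_deriv ?_
  simp only [angleField, angleForce, decayRate, ← pCos_mul_pFlux (one_pos.trans hp),
    Function.comp_apply]
  ring

theorem continuousOn_deriv_wave (hp : 1 < p) (hα : 0 < α) (hρ : 0 < ρ) (ha : 0 ≤ a)
    (h : IsStart (angleForce p) α K (-quarterPeriod p) ρ a ϑ) :
    ContinuousOn (deriv (wave p K a ϑ)) (Ioi a) := by
  have hcont : ContinuousOn (fun t => α * amplitude p K a ϑ t * pCos p (ϑ t)) (Ioi a) :=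
    (continuousOn_const.mul fun t ht =>
      (hasDerivAt_amplitude hp hα hρ ha h ht).continuousAt.continuousWithinAt).mul
      ((continuous_pCos hp).comp_continuousOn (h.isAngle.mono ha).continuousOn)
  exact hcont.congr fun t ht => (hasDerivAt_wave hp hα hρ ha h ht).deriv

theorem wave_init (hp : 1 < p) (hρ : 0 ≤ ρ)
    (h : IsStart (angleForce p) α K (-quarterPeriod p) ρ a ϑ) : wave p K a ϑ a = -1 := by
  rw [wave, amplitude_self, h.init hρ, pSin_neg_quarterPeriod hp, one_mul]

theorem hasDerivWithinAt_wave_init (hp : 1 < p) (hα : 0 < α) (hρ : 0 < ρ) (ha : 0 ≤ a)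
    (h : IsStart (angleForce p) α K (-quarterPeriod p) ρ a ϑ) :
    HasDerivWithinAt (wave p K a ϑ) 0 (Ici a) a := by
  have hderiv := fun t (ht : t ∈ Ioi a) => hasDerivAt_wave hp hα hρ ha h ht
  have hamp := tendsto_amplitude hp hα hρ ha h
  have hϑ := h.tendsto hα hρ
  have hlim : Tendsto (wave p K a ϑ) (𝓝[>] a) (𝓝 (-1)) := by
    have hprod := hamp.mul (((continuous_pSin hp).tendsto _).comp hϑ)
    rwa [pSin_neg_quarterPeriod hp, one_mul] at hprod
  have hlim' : Tendsto (deriv (wave p K a ϑ)) (𝓝[>] a) (𝓝 0) := by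
    have hprod := (hamp.const_mul α).mul (((continuous_pCos hp).tendsto _).comp hϑ)
    rw [pCos_neg_quarterPeriod hp, mul_zero] at hprod
    exact hprod.congr' (eventually_mem_nhdsWithin.mono fun t ht => (hderiv t ht).deriv.symm)
  refine hasDerivWithinAt_Ici_of_tendsto_deriv
    (fun t ht => (hderiv t ht).differentiableAt.differentiableWithinAt) ?_ self_mem_nhdsWithin
    hlim'
  rwa [ContinuousWithinAt, wave_init hp hρ.le h]

theorem signedPow_deriv_wave (hp : 1 < p) (hα : 0 < α) (hρ : 0 < ρ) (ha : 0 ≤ a)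
    (h : IsStart (angleForce p) α K (-quarterPeriod p) ρ a ϑ) (hat : a < t) :
    signedPow p (deriv (wave p K a ϑ) t) =
      (α * amplitude p K a ϑ t) ^ (p - 1) * pFlux p (ϑ t) := by
  rw [(hasDerivAt_wave hp hα hρ ha h hat).deriv, signedPow_eq_spow,
    spow_const_mul (mul_pos hα (amplitude_pos _ _ _ _ _)), pFlux]

theorem hasDerivAt_signedPow_deriv_wave (hp : 1 < p) (hα : 0 < α) (hρ : 0 < ρ) (ha : 0 ≤ a)
    (h : IsStart (angleForce p) α K (-quarterPeriod p) ρ a ϑ) (hat : a < t) :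
    HasDerivAt (fun s => signedPow p (deriv (wave p K a ϑ) s))
      (-(K * (p - 1)) / t * signedPow p (deriv (wave p K a ϑ) t)
        - (p - 1) * α ^ p * signedPow p (wave p K a ϑ t)) t := by
  have ht : 0 < t := ha.trans_lt hat
  have hA := amplitude_pos p K a ϑ t
  have hαA : α * amplitude p K a ϑ t ≠ 0 := (mul_pos hα hA).ne'
  have hprod := (((hasDerivAt_amplitude hp hα hρ ha h hat).const_mul α).rpow_const (p := p - 1)
    (Or.inl hαA)).mul ((hasDerivAt_pFlux hp (ϑ t)).comp t (h.isAngle t ht))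
  refine (hprod.congr_of_eventuallyEq ?_).congr_deriv ?_
  · filter_upwards [Ioi_mem_nhds hat] with s hs using signedPow_deriv_wave hp hα hρ ha h hs
  have hpyth : |pCos p (ϑ t)| ^ p = 1 - pSin p (ϑ t) * spow (p - 1) (pSin p (ϑ t)) := by
    rw [pSin_mul_spow (one_pos.trans hp)]
    exact eq_sub_of_add_eq' (abs_pSin_rpow_add_abs_pCos_rpow (one_pos.trans hp) _)
  have hαp : α ^ p = α * α ^ (p - 1) := by rw [Real.rpow_sub_one hα.ne']; field_simp
  rw [signedPow_deriv_wave hp hα hρ ha h hat, signedPow_eq_spow, wave, spow_const_mul hA,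
    Real.rpow_sub_one hαA, Real.mul_rpow hα.le hA.le, hαp]
  simp only [Function.comp_apply, angleField, angleForce, decayRate, hpyth]
  field_simp
  ring

end Wave

section Parameters

variable {lam n a ρ : ℝ} {ϑ : ℝ → ℝ}

theorem alpha_pos (hp : 1 < p) (hlam : 0 < lam) : 0 < alpha p lam := by
  unfold alpha; positivity

theorem sub_one_mul_alpha_rpow (hp : 1 < p) (hlam : 0 < lam) :
    (p - 1) * alpha p lam ^ p = lam := by
  have hp' : 0 < p - 1 := sub_pos.2 hp
  rw [alpha, ← Real.rpow_mul (by positivity), one_div_mul_cancel (by linarith), Real.rpow_one,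
    mul_div_cancel₀ _ hp'.ne']

theorem isSolution_wave (hp : 1 < p) (hlam : 0 < lam) (hρ : 0 < ρ) (ha : 0 ≤ a)
    (h : IsStart (angleForce p) (alpha p lam) ((n - 1) / (p - 1)) (-quarterPeriod p) ρ a ϑ) :
    IsSolution p lam (damping n) a (wave p ((n - 1) / (p - 1)) a ϑ) := by
  have hα := alpha_pos hp hlam
  refine ⟨wave_init hp hρ.le h, hasDerivWithinAt_wave_init hp hα hρ ha h, ?_, fun t ht => ?_⟩
  · have hderiv := fun t (ht : t ∈ Ioi a) => hasDerivAt_wave hp hα hρ ha h ht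
    exact (contDiffOn_one_iff_derivWithin isOpen_Ioi.uniqueDiffOn).2
      ⟨fun t ht => (hderiv t ht).differentiableAt.differentiableWithinAt,
        (continuousOn_deriv_wave hp hα hρ ha h).congr
          fun t ht => derivWithin_of_isOpen isOpen_Ioi ht⟩
  · have hode := hasDerivAt_signedPow_deriv_wave hp hα hρ ha h ht
    rwa [sub_one_mul_alpha_rpow hp hlam, div_mul_cancel₀ _ (sub_pos.2 hp).ne'] at hode

end Parameters

/-! ### Uniqueness -/

theorem frequently_abs_deriv_lt {v : ℝ → ℝ} {a ε : ℝ} (h₀ : HasDerivWithinAt v 0 (Ici a) a)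
    (hv : DifferentiableOn ℝ v (Ioi a)) (hε : 0 < ε) : ∃ᶠ s in 𝓝[>] a, |deriv v s| < ε := by
  refine frequently_iff.2 fun hU => ?_
  obtain ⟨d, had, hd⟩ := mem_nhdsGT_iff_exists_Ioo_subset.1 hU
  have hslope : Tendsto (slope v a) (𝓝[>] a) (𝓝 0) :=
    (hasDerivWithinAt_iff_tendsto_slope' self_notMem_Ioi).1 h₀.Ioi_of_Ici
  have hsmall := hslope.abs.eventually_lt_const (by rwa [abs_zero])
  obtain ⟨x, hx, hax, hxd⟩ := (hsmall.and (Ioo_mem_nhdsGT had)).exists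
  have hcont : ContinuousOn v (Icc a x) := fun y hy => by
    rcases hy.1.eq_or_lt with rfl | hay
    · exact h₀.continuousWithinAt.mono Icc_subset_Ici_self
    · exact (hv.differentiableAt (Ioi_mem_nhds hay)).continuousAt.continuousWithinAt
  obtain ⟨s, hs, hds⟩ := exists_deriv_eq_slope v hax hcont (hv.mono Ioo_subset_Ioi_self)
  exact ⟨s, hd ⟨hs.1, hs.2.trans hxd⟩, by rwa [hds, ← slope_def_field]⟩

theorem abs_le_abs_add_of_hasDerivAt_damping {φ f : ℝ → ℝ} {n s t C : ℝ} (hn : 1 ≤ n) (hs : 0 < s)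
    (hst : s ≤ t) (hφ : ∀ x ∈ Icc s t, HasDerivAt φ (damping n x * φ x - f x) x)
    (hf : ∀ x ∈ Icc s t, |f x| ≤ C) : |φ t| ≤ |φ s| + C * (t - s) := by
  have hn' : 0 ≤ n - 1 := sub_nonneg.2 hn
  have hderiv : ∀ x ∈ Icc s t,
      HasDerivAt (fun x => x ^ (n - 1) * φ x) (-(x ^ (n - 1) * f x)) x := fun x hx => by
    have hx0 : 0 < x := hs.trans_le hx.1
    refine ((Real.hasDerivAt_rpow_const (p := n - 1) (Or.inl hx0.ne')).mul (hφ x hx)).congr_deriv ?_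
    rw [Real.rpow_sub_one hx0.ne', damping]
    field_simp
    ring
  have hbound : ∀ x ∈ Icc s t, ‖-(x ^ (n - 1) * f x)‖ ≤ t ^ (n - 1) * C := fun x hx => by
    have hx0 : 0 < x := hs.trans_le hx.1
    rw [norm_neg, norm_mul, Real.norm_of_nonneg (by positivity)]
    exact mul_le_mul (Real.rpow_le_rpow hx0.le hx.2 hn') (hf x hx) (abs_nonneg _)
      (Real.rpow_nonneg (hs.le.trans hst) _)
  have hmean := (convex_Icc s t).norm_image_sub_le_of_norm_hasDerivWithin_le
    (fun x hx => (hderiv x hx).hasDerivWithinAt) hbound ⟨le_rfl, hst⟩ ⟨hst, le_rfl⟩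
  have ht : 0 < t ^ (n - 1) := Real.rpow_pos_of_pos (hs.trans_le hst) _
  refine le_of_mul_le_mul_left ?_ ht
  calc t ^ (n - 1) * |φ t| = |t ^ (n - 1) * φ t| := by rw [abs_mul, abs_of_pos ht]
    _ ≤ |s ^ (n - 1) * φ s| + |t ^ (n - 1) * φ t - s ^ (n - 1) * φ s| := by
      rw [add_comm]; exact sub_le_iff_le_add.1 (abs_sub_abs_le_abs_sub _ _)
    _ ≤ t ^ (n - 1) * |φ s| + t ^ (n - 1) * C * (t - s) := by
      rw [abs_mul, abs_of_pos (Real.rpow_pos_of_pos hs _)]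
      rw [Real.norm_eq_abs, Real.norm_of_nonneg (sub_nonneg.2 hst)] at hmean
      gcongr
    _ = t ^ (n - 1) * (|φ s| + C * (t - s)) := by ring

/-- The energy of the phase curve `(v, v'/α)`; it is the `p`-th power of the amplitude. -/
def energy (p α : ℝ) (v : ℝ → ℝ) (t : ℝ) : ℝ := |v t| ^ p + |deriv v t / α| ^ p

theorem spow_inv_signedPow (hp : 1 < p) (x : ℝ) : spow (1 / (p - 1)) (signedPow p x) = x := by
  have hp' : p - 1 ≠ 0 := (sub_pos.2 hp).ne'
  rw [signedPow_eq_spow, spow_spow _ hp', mul_one_div_cancel hp', spow_one]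

theorem abs_signedPow (hp : 1 < p) (x : ℝ) : |signedPow p x| = |x| ^ (p - 1) :=
  abs_spow (sub_pos.2 hp).ne' x

theorem mul_signedPow (hp : 0 < p) (x : ℝ) : x * signedPow p x = |x| ^ p := by
  rw [signedPow_eq_spow, mul_spow (by linarith), sub_add_cancel]

section Solution

variable {lam n a t : ℝ} {T v : ℝ → ℝ}

theorem IsSolution.differentiableOn (h : IsSolution p lam T a v) :
    DifferentiableOn ℝ v (Ioi a) :=
  h.contDiffOn.differentiableOn one_ne_zero

theorem IsSolution.hasDerivAt (h : IsSolution p lam T a v) (hat : a < t) :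
    HasDerivAt v (deriv v t) t :=
  (h.differentiableOn.differentiableAt (Ioi_mem_nhds hat)).hasDerivAt

theorem IsSolution.continuousOn (h : IsSolution p lam T a v) : ContinuousOn v (Ici a) := by
  intro t (hat : a ≤ t)
  rcases hat.eq_or_lt with rfl | hat
  · exact h.init_deriv.continuousWithinAt
  · exact (h.hasDerivAt hat).continuousAt.continuousWithinAt

theorem IsSolution.tendsto (h : IsSolution p lam T a v) : Tendsto v (𝓝[>] a) (𝓝 (-1)) :=
  h.init ▸ h.init_deriv.continuousWithinAt.mono Ioi_subset_Ici_self

theorem IsSolution.exists_abs_signedPow_deriv_le (hp : 1 < p) (hn : 1 ≤ n) (ha : 0 ≤ a)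
    (h : IsSolution p lam (damping n) a v) :
    ∃ C, ∀ᶠ t in 𝓝[>] a, |signedPow p (deriv v t)| ≤ C * (t - a) := by
  have hv : ∀ᶠ t in 𝓝[>] a, |v t| < 2 := h.tendsto.abs.eventually_lt_const (by norm_num)
  obtain ⟨d, had, hd⟩ := mem_nhdsGT_iff_exists_Ioo_subset.1 hv
  have hsource : ∀ t ∈ Ioo a d, |lam * signedPow p (v t)| ≤ |lam| * 2 ^ (p - 1) := fun t ht => by
    rw [abs_mul, abs_signedPow hp]
    gcongr
    exact (hd ht).le
  refine ⟨|lam| * 2 ^ (p - 1), ?_⟩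
  filter_upwards [Ioo_mem_nhdsGT had] with t ht
  refine le_of_forall_pos_le_add fun ε hε => ?_
  obtain ⟨s, hs, has, hst⟩ := ((frequently_abs_deriv_lt h.init_deriv h.differentiableOn
    (Real.rpow_pos_of_pos hε (p - 1)⁻¹)).and_eventually (Ioo_mem_nhdsGT ht.1)).exists
  have hsmall : |signedPow p (deriv v s)| ≤ ε := by
    rw [abs_signedPow hp, ← Real.rpow_inv_rpow hε.le (sub_pos.2 hp).ne']
    exact Real.rpow_le_rpow (abs_nonneg _) hs.le (sub_pos.2 hp).le
  have hgrow := abs_le_abs_add_of_hasDerivAt_damping hn (ha.trans_lt has) hst.le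
    (fun x hx => h.ode x (has.trans_le hx.1))
    (fun x hx => hsource x ⟨has.trans_le hx.1, hx.2.trans_lt ht.2⟩)
  rw [add_comm]
  exact hgrow.trans (by gcongr)

theorem IsSolution.tendsto_deriv (hp : 1 < p) (hn : 1 ≤ n) (ha : 0 ≤ a)
    (h : IsSolution p lam (damping n) a v) : Tendsto (deriv v) (𝓝[>] a) (𝓝 0) := by
  obtain ⟨C, hC⟩ := h.exists_abs_signedPow_deriv_le hp hn ha
  have hflux : Tendsto (fun t => signedPow p (deriv v t)) (𝓝[>] a) (𝓝 0) :=
    squeeze_zero_norm' hC (tendsto_const_mul_sub_nhdsGT C a)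
  have hspow := ((continuous_spow (one_div_pos.2 (sub_pos.2 hp))).tendsto 0).comp hflux
  rw [spow_zero] at hspow
  exact hspow.congr fun t => spow_inv_signedPow hp _

theorem IsSolution.hasDerivAt_abs_deriv_rpow (hp : 1 < p) (h : IsSolution p lam T a v)
    (hat : a < t) : HasDerivAt (fun s => |deriv v s| ^ p) (p / (p - 1) * deriv v t *
      (T t * signedPow p (deriv v t) - lam * signedPow p (v t))) t := by
  have hp' : 0 < p - 1 := sub_pos.2 hp
  have hexp : 1 < p / (p - 1) := (one_lt_div hp').2 (by linarith)
  have hpow : ∀ s, |deriv v s| ^ p = |signedPow p (deriv v s)| ^ (p / (p - 1)) := fun s => by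
    rw [abs_signedPow hp, ← Real.rpow_mul (abs_nonneg _), mul_div_cancel₀ _ hp'.ne']
  have hconj : p / (p - 1) - 1 = 1 / (p - 1) := by field_simp; ring
  have hcomp := (hasDerivAt_abs_rpow_spow hexp (signedPow p (deriv v t))).comp t (h.ode t hat)
  rw [hconj, spow_inv_signedPow hp] at hcomp
  exact hcomp.congr_of_eventuallyEq (.of_forall hpow)

theorem IsSolution.hasDerivAt_energy (hp : 1 < p) (hlam : 0 < lam)
    (h : IsSolution p lam (damping n) a v) (hat : a < t) :
    HasDerivAt (energy p (alpha p lam) v)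
      (-(p * ((n - 1) / (p - 1)) / t) * |deriv v t / alpha p lam| ^ p) t := by
  have hα := alpha_pos hp hlam
  have hp' : 0 < p - 1 := sub_pos.2 hp
  have hdiv : ∀ s, |deriv v s / alpha p lam| ^ p = |deriv v s| ^ p / alpha p lam ^ p := fun s => by
    rw [abs_div, abs_of_pos hα, Real.div_rpow (abs_nonneg _) hα.le]
  have hsum := ((hasDerivAt_abs_rpow_spow hp (v t)).comp t (h.hasDerivAt hat)).add
    ((h.hasDerivAt_abs_deriv_rpow hp hat).div_const (alpha p lam ^ p))
  refine (hsum.congr_of_eventuallyEq (.of_forall fun s => by simp only [energy, hdiv]; rfl))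
    |>.congr_deriv ?_
  rw [hdiv, ← mul_signedPow (one_pos.trans hp), damping, ← signedPow_eq_spow]
  nth_rw 1 [← sub_one_mul_alpha_rpow hp hlam]
  field_simp
  ring

theorem IsSolution.tendsto_energy (hp : 1 < p) (hn : 1 ≤ n) (ha : 0 ≤ a)
    (h : IsSolution p lam (damping n) a v) (α : ℝ) :
    Tendsto (energy p α v) (𝓝[>] a) (𝓝 1) := by
  have hp0 : 0 < p := one_pos.trans hp
  have hsum := (h.tendsto.abs.rpow_const (p := p) (Or.inr hp0.le)).add
    (((h.tendsto_deriv hp hn ha).div_const α).abs.rpow_const (p := p) (Or.inr hp0.le))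
  rwa [abs_neg, abs_one, Real.one_rpow, zero_div, abs_zero, Real.zero_rpow hp0.ne', add_zero]
    at hsum

theorem IsSolution.monotoneOn_rpow_mul_energy (hp : 1 < p) (hlam : 0 < lam) (hn : 1 ≤ n)
    (ha : 0 ≤ a) (h : IsSolution p lam (damping n) a v) :
    MonotoneOn (fun t => t ^ (p * ((n - 1) / (p - 1))) * energy p (alpha p lam) v t) (Ioi a) := by
  set κ := p * ((n - 1) / (p - 1)) with hκ
  have hderiv : ∀ t, a < t → HasDerivAt (fun t => t ^ κ * energy p (alpha p lam) v t)
      (κ * t ^ (κ - 1) * |v t| ^ p) t := fun t hat => by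
    have ht : 0 < t := ha.trans_lt hat
    refine ((Real.hasDerivAt_rpow_const (p := κ) (Or.inl ht.ne')).mul
      (h.hasDerivAt_energy hp hlam hat)).congr_deriv ?_
    rw [energy, Real.rpow_sub_one ht.ne', ← hκ]
    field_simp
    ring
  refine monotoneOn_of_hasDerivWithinAt_nonneg (convex_Ioi a)
    (fun t ht => (hderiv t ht).continuousAt.continuousWithinAt)
    (fun t ht => (hderiv t (interior_subset ht)).hasDerivWithinAt) fun t ht => ?_
  have ht : 0 < t := ha.trans_lt (interior_subset ht)
  positivity

theorem IsSolution.energy_pos (hp : 1 < p) (hlam : 0 < lam) (hn : 1 ≤ n) (ha : 0 ≤ a)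
    (h : IsSolution p lam (damping n) a v) (hat : a < t) : 0 < energy p (alpha p lam) v t := by
  obtain ⟨s, hs, has, hst⟩ := (((h.tendsto_energy hp hn ha (alpha p lam)).eventually_const_lt
    one_pos).and (Ioo_mem_nhdsGT hat)).exists
  have hs0 : 0 < s := ha.trans_lt has
  have hmono := h.monotoneOn_rpow_mul_energy hp hlam hn ha has hat hst.le
  exact pos_of_mul_pos_right ((mul_pos (Real.rpow_pos_of_pos hs0 _) hs).trans_le hmono)
    (Real.rpow_nonneg (hs0.le.trans hst.le) _)

end Solution

theorem exists_continuousOn_exp_eq {z : ℝ → ℂ} {a : ℝ} {w₀ : ℂ} (hz : ContinuousOn z (Ici a))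
    (hne : ∀ t ∈ Ici a, z t ≠ 0) (hw₀ : Complex.exp w₀ = z a) :
    ∃ f : ℝ → ℂ, ContinuousOn f (Ici a) ∧ f a = w₀ ∧ ∀ t ∈ Ici a, Complex.exp (f t) = z t := by
  have hcont : Continuous fun t => z (max t a) :=
    hz.comp_continuous (continuous_id.max continuous_const) fun t => le_max_right t a
  have hsimply : IsSimplyConnected (univ : Set ℝ) :=
    haveI := (convex_univ (𝕜 := ℝ) (E := ℝ)).contractibleSpace univ_nonempty
    SimplyConnectedSpace.ofContractible _
  obtain ⟨f, hf, hexp⟩ := Complex.exists_continuousOn_eqOn_exp_comp hsimply isOpen_univ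
    hcont.continuousOn (by rintro ⟨t, -, ht⟩; exact hne _ (le_max_right t a) ht)
  have hexp' : ∀ t ∈ Ici a, Complex.exp (f t) = z t := fun t (ht : a ≤ t) => by
    simpa only [Function.comp_apply, max_eq_left ht] using hexp (mem_univ t)
  refine ⟨fun t => f t - f a + w₀, ?_, by simp, fun t ht => ?_⟩
  · exact ((hf.mono (subset_univ _)).sub continuousOn_const).add continuousOn_const
  · rw [Complex.exp_add, Complex.exp_sub, hexp' t ht, hexp' a self_mem_Ici, hw₀,
      div_mul_cancel₀ _ (hne a self_mem_Ici)]

theorem exists_continuousOn_polar {x y : ℝ → ℝ} {a r₀ θ₀ : ℝ} (hp : 1 < p)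
    (hx : ContinuousOn x (Ici a)) (hy : ContinuousOn y (Ici a))
    (hne : ∀ t ∈ Ici a, x t ≠ 0 ∨ y t ≠ 0) (hr₀ : 0 < r₀) (hxa : x a = r₀ * pSin p θ₀)
    (hya : y a = r₀ * pCos p θ₀) :
    ∃ r ϑ : ℝ → ℝ, ContinuousOn ϑ (Ici a) ∧ ϑ a = θ₀ ∧
      ∀ t ∈ Ici a, 0 < r t ∧ x t = r t * pSin p (ϑ t) ∧ y t = r t * pCos p (ϑ t) := by
  have hp' : 0 < p / 2 := by linarith
  have hspow : ∀ s, spow (2 / p) (spow (p / 2) s) = s := fun s => by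
    rw [spow_spow _ hp'.ne', div_mul_div_cancel₀' (by linarith), div_self two_ne_zero, spow_one]
  have hspow' : ∀ s, spow (p / 2) (spow (2 / p) s) = s := fun s => by
    rw [spow_spow _ (by positivity), div_mul_div_cancel₀ (by linarith), div_self two_ne_zero,
      spow_one]
  let z : ℝ → ℂ := fun t => ⟨spow (p / 2) (y t), spow (p / 2) (x t)⟩
  have hz : ContinuousOn z (Ici a) :=
    Complex.equivRealProdCLM.symm.continuous.comp_continuousOn
      (((continuous_spow hp').comp_continuousOn hy).prodMk
        ((continuous_spow hp').comp_continuousOn hx))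
  have hz0 : ∀ t ∈ Ici a, z t ≠ 0 := fun t ht h0 => (hne t ht).elim
    (fun h => h (spow_eq_zero.1 (congrArg Complex.im h0)))
    (fun h => h (spow_eq_zero.1 (congrArg Complex.re h0)))
  have hza : Complex.exp ⟨log (r₀ ^ (p / 2)), eucAngle p θ₀⟩ = z a := by
    have hexp := Real.exp_log (Real.rpow_pos_of_pos hr₀ (p / 2))
    apply Complex.ext
    · simp only [Complex.exp_re, hexp, z, hya, spow_const_mul hr₀, pCos, hspow']
    · simp only [Complex.exp_im, hexp, z, hxa, spow_const_mul hr₀, pSin, hspow']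
  obtain ⟨f, hf, hfa, hexp⟩ := exists_continuousOn_exp_eq hz hz0 hza
  refine ⟨fun t => Real.exp (f t).re ^ (2 / p), fun t => genAngle p (f t).im,
    (continuous_genAngle hp).comp_continuousOn (Complex.continuous_im.comp_continuousOn hf),
    by simp only [hfa, genAngle_eucAngle hp], fun t ht => ⟨by positivity, ?_, ?_⟩⟩
  · rw [pSin, eucAngle_genAngle hp, ← spow_const_mul (exp_pos _), ← Complex.exp_im, hexp t ht,
      hspow]
  · rw [pCos, eucAngle_genAngle hp, ← spow_const_mul (exp_pos _), ← Complex.exp_re, hexp t ht,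
      hspow]

/-- `(R, ϑ)` are continuous polar coordinates, with respect to the generalized trigonometric
functions, of the phase curve `(v, v'/α)` on `(a, ∞)`, the angle starting at `-π_p/2`. -/
structure IsPolar (p α a : ℝ) (v R ϑ : ℝ → ℝ) : Prop where
  tendsto : Tendsto ϑ (𝓝[>] a) (𝓝 (-quarterPeriod p))
  continuousOn : ContinuousOn ϑ (Ioi a)
  pos : ∀ t, a < t → 0 < R t
  eq_mul_pSin : ∀ t, a < t → v t = R t * pSin p (ϑ t)
  deriv_eq : ∀ t, a < t → deriv v t = α * R t * pCos p (ϑ t)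

theorem hasDerivAt_angle {ϑ : ℝ → ℝ} {m t : ℝ} (hp : 1 < p) (hϑ : ContinuousAt ϑ t)
    (hsin : HasDerivAt (fun s => pSin p (ϑ s)) (pCos p (ϑ t) * m) t)
    (hflux : HasDerivAt (fun s => pFlux p (ϑ s)) (-(p - 1) * spow (p - 1) (pSin p (ϑ t)) * m) t) :
    HasDerivAt ϑ m t := by
  by_cases hcos : pCos p (ϑ t) = 0
  · have hsin0 : pSin p (ϑ t) ≠ 0 := fun h0 => by
      have hp0 : p ≠ 0 := by linarith
      simpa [hcos, h0, hp0] using abs_pSin_rpow_add_abs_pCos_rpow (one_pos.trans hp) (ϑ t)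
    have hne : -(p - 1) * spow (p - 1) (pSin p (ϑ t)) ≠ 0 :=
      mul_ne_zero (by linarith) (mt spow_eq_zero.1 hsin0)
    have h := HasDerivAt.of_comp_left hϑ (hasDerivAt_pFlux hp (ϑ t)) hflux hne .rfl
    rwa [mul_div_cancel_left₀ _ hne] at h
  · have h := HasDerivAt.of_comp_left hϑ (hasDerivAt_pSin hp (ϑ t)) hsin hcos .rfl
    rwa [mul_div_cancel_left₀ _ hcos] at h

section Polar

variable {α lam n ρ a t : ℝ} {v R ϑ : ℝ → ℝ}

theorem IsSolution.exists_isPolar (hp : 1 < p) (hlam : 0 < lam) (hn : 1 ≤ n) (ha : 0 ≤ a)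
    (h : IsSolution p lam (damping n) a v) : ∃ R ϑ, IsPolar p (alpha p lam) a v R ϑ := by
  have hα := alpha_pos hp hlam
  have hderiv : ∀ t, a < t → derivWithin v (Ici a) t = deriv v t := fun t hat =>
    derivWithin_of_mem_nhds (Ici_mem_nhds hat)
  have hderiv₀ : derivWithin v (Ici a) a = 0 := h.init_deriv.derivWithin (uniqueDiffWithinAt_Ici a)
  have hcont : ContinuousOn (derivWithin v (Ici a)) (Ici a) := by
    intro t (hat : a ≤ t)
    rcases hat.eq_or_lt with rfl | hat
    · rw [← continuousWithinAt_Ioi_iff_Ici, ContinuousWithinAt, hderiv₀]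
      exact (h.tendsto_deriv hp hn ha).congr'
        (eventually_mem_nhdsWithin.mono fun t ht => (hderiv t ht).symm)
    · have hdiff := (h.contDiffOn.continuousOn_deriv_of_isOpen isOpen_Ioi le_rfl).continuousAt
        (Ioi_mem_nhds hat)
      exact (hdiff.congr (eventually_of_mem (Ioi_mem_nhds hat) fun s hs => (hderiv s hs).symm))
        |>.continuousWithinAt
  have hne : ∀ t ∈ Ici a, v t ≠ 0 ∨ derivWithin v (Ici a) t / alpha p lam ≠ 0 := by
    intro t (hat : a ≤ t)
    rcases hat.eq_or_lt with rfl | hat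
    · exact Or.inl (by rw [h.init]; norm_num)
    · by_contra! h0
      rw [hderiv t hat] at h0
      have hpos := h.energy_pos hp hlam hn ha hat
      rw [energy, h0.1, h0.2, abs_zero, Real.zero_rpow (by linarith), add_zero] at hpos
      exact hpos.false
  obtain ⟨R, ϑ, hϑ, hϑa, hpolar⟩ := exists_continuousOn_polar hp h.continuousOn
    (hcont.div_const (alpha p lam)) hne one_pos (θ₀ := -quarterPeriod p)
    (by rw [h.init, pSin_neg_quarterPeriod hp, one_mul])
    (by rw [hderiv₀, pCos_neg_quarterPeriod hp, zero_div, mul_zero])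
  refine ⟨R, ϑ, ?_, hϑ.mono Ioi_subset_Ici_self, fun t ht => (hpolar t ht.le).1,
    fun t ht => (hpolar t ht.le).2.1, fun t ht => ?_⟩
  · rw [← hϑa]
    exact (hϑ a self_mem_Ici).mono Ioi_subset_Ici_self
  · rw [← hderiv t ht, mul_assoc, ← (hpolar t ht.le).2.2, mul_div_cancel₀ _ hα.ne']

theorem IsPolar.rpow_eq_energy (hp : 0 < p) (hα : 0 < α) (h : IsPolar p α a v R ϑ) (hat : a < t) :
    R t ^ p = energy p α v t := by
  rw [energy, h.deriv_eq t hat, h.eq_mul_pSin t hat, mul_assoc, mul_div_cancel_left₀ _ hα.ne',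
    abs_mul, abs_mul, abs_of_pos (h.pos t hat), Real.mul_rpow (h.pos t hat).le (abs_nonneg _),
    Real.mul_rpow (h.pos t hat).le (abs_nonneg _), ← mul_add,
    abs_pSin_rpow_add_abs_pCos_rpow hp, mul_one]

theorem IsPolar.eq_energy_rpow (hp : 0 < p) (hα : 0 < α) (h : IsPolar p α a v R ϑ) (hat : a < t) :
    R t = energy p α v t ^ (1 / p) := by
  rw [← h.rpow_eq_energy hp hα hat, one_div, Real.rpow_rpow_inv (h.pos t hat).le hp.ne']

theorem IsPolar.hasDerivAt_radius (hp : 1 < p) (hlam : 0 < lam)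
    (hv : IsSolution p lam (damping n) a v) (h : IsPolar p (alpha p lam) a v R ϑ) (hat : a < t) :
    HasDerivAt R (-((n - 1) / (p - 1)) * decayRate p ϑ t * R t) t := by
  have hα := alpha_pos hp hlam
  have hp0 : 0 < p := one_pos.trans hp
  have hR := h.pos t hat
  have henergy := h.rpow_eq_energy hp0 hα hat
  have hcos : |deriv v t / alpha p lam| ^ p = R t ^ p * |pCos p (ϑ t)| ^ p := by
    rw [h.deriv_eq t hat, mul_assoc, mul_div_cancel_left₀ _ hα.ne', abs_mul, abs_of_pos hR,
      Real.mul_rpow hR.le (abs_nonneg _)]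
  have hpow := (hv.hasDerivAt_energy hp hlam hat).rpow_const (p := 1 / p)
    (Or.inl (by rw [← henergy]; positivity))
  refine (hpow.congr_of_eventuallyEq ?_).congr_deriv ?_
  · filter_upwards [Ioi_mem_nhds hat] with s hs using h.eq_energy_rpow hp0 hα hs
  · rw [hcos, Real.rpow_sub_one (by rw [← henergy]; positivity), ← h.eq_energy_rpow hp0 hα hat,
      ← henergy, decayRate]
    field_simp

theorem IsPolar.hasDerivAt_pSin (hp : 1 < p) (hlam : 0 < lam)
    (hv : IsSolution p lam (damping n) a v) (h : IsPolar p (alpha p lam) a v R ϑ) (hat : a < t) :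
    HasDerivAt (fun s => pSin p (ϑ s)) (pCos p (ϑ t) *
      angleField (angleForce p) (alpha p lam) ((n - 1) / (p - 1)) t (ϑ t)) t := by
  have hR := (h.pos t hat).ne'
  have hquot := (hv.hasDerivAt hat).div (h.hasDerivAt_radius hp hlam hv hat) hR
  refine (hquot.congr_of_eventuallyEq ?_).congr_deriv ?_
  · filter_upwards [Ioi_mem_nhds hat] with s hs
    rw [Pi.div_apply, h.eq_mul_pSin s hs, mul_div_cancel_left₀ _ (h.pos s hs).ne']
  · rw [h.deriv_eq t hat, h.eq_mul_pSin t hat, decayRate, angleField, angleForce,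
      ← pCos_mul_pFlux (one_pos.trans hp)]
    field_simp
    ring

theorem IsPolar.signedPow_deriv (hα : 0 < α) (h : IsPolar p α a v R ϑ) (hat : a < t) :
    signedPow p (deriv v t) = (α * R t) ^ (p - 1) * pFlux p (ϑ t) := by
  rw [h.deriv_eq t hat, signedPow_eq_spow, spow_const_mul (mul_pos hα (h.pos t hat)), pFlux]

theorem IsPolar.hasDerivAt_pFlux (hp : 1 < p) (hlam : 0 < lam) (ha : 0 ≤ a)
    (hv : IsSolution p lam (damping n) a v) (h : IsPolar p (alpha p lam) a v R ϑ) (hat : a < t) :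
    HasDerivAt (fun s => pFlux p (ϑ s)) (-(p - 1) * spow (p - 1) (pSin p (ϑ t)) *
      angleField (angleForce p) (alpha p lam) ((n - 1) / (p - 1)) t (ϑ t)) t := by
  have hα := alpha_pos hp hlam
  have hαlam := sub_one_mul_alpha_rpow hp hlam
  set α := alpha p lam
  have ht : 0 < t := ha.trans_lt hat
  have hp' : 0 < p - 1 := sub_pos.2 hp
  have hR := h.pos t hat
  have hαR : ∀ s, a < s → 0 < α * R s := fun s hs => mul_pos hα (h.pos s hs)
  have hquot := (hv.ode t hat).div (((h.hasDerivAt_radius hp hlam hv hat).const_mul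
    α).rpow_const (p := p - 1) (Or.inl (hαR t hat).ne'))
    (Real.rpow_pos_of_pos (hαR t hat) _).ne'
  refine (hquot.congr_of_eventuallyEq ?_).congr_deriv ?_
  · filter_upwards [Ioi_mem_nhds hat] with s hs
    rw [Pi.div_apply, h.signedPow_deriv hα hs,
      mul_div_cancel_left₀ _ (Real.rpow_pos_of_pos (hαR s hs) _).ne']
  have hpyth : |pCos p (ϑ t)| ^ p = 1 - pSin p (ϑ t) * spow (p - 1) (pSin p (ϑ t)) := by
    rw [pSin_mul_spow (one_pos.trans hp)]
    exact eq_sub_of_add_eq' (abs_pSin_rpow_add_abs_pCos_rpow (one_pos.trans hp) _)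
  have hαp : α ^ p = α * α ^ (p - 1) := by rw [Real.rpow_sub_one hα.ne']; field_simp
  rw [h.signedPow_deriv hα hat, h.eq_mul_pSin t hat, signedPow_eq_spow, spow_const_mul hR,
    Real.rpow_sub_one (hαR t hat).ne' (p - 1), Real.mul_rpow hα.le hR.le, decayRate, hpyth,
    damping, angleField, angleForce, ← hαlam, hαp]
  field_simp
  ring

theorem IsPolar.isAngle (hp : 1 < p) (hlam : 0 < lam) (ha : 0 ≤ a)
    (hv : IsSolution p lam (damping n) a v) (h : IsPolar p (alpha p lam) a v R ϑ) :
    IsAngle (angleForce p) (alpha p lam) ((n - 1) / (p - 1)) a ϑ := fun _ hat =>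
  hasDerivAt_angle hp (h.continuousOn.continuousAt (Ioi_mem_nhds hat))
    (h.hasDerivAt_pSin hp hlam hv hat) (h.hasDerivAt_pFlux hp hlam ha hv hat)

theorem IsPolar.eqOn_angle {ψ : ℝ → ℝ} (hp : 1 < p) (hlam : 0 < lam) (hn : 1 ≤ n) (ha : 0 ≤ a)
    (hρ : 0 < ρ) (hv : IsSolution p lam (damping n) a v) (h : IsPolar p (alpha p lam) a v R ϑ)
    (hψ : IsStart (angleForce p) (alpha p lam) ((n - 1) / (p - 1)) (-quarterPeriod p) ρ a ψ) :
    EqOn ϑ ψ (Ioi a) := by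
  obtain ⟨r, hr, hanti⟩ := exists_antitoneOn_angleForce hp
  exact (h.isAngle hp hlam ha hv).eqOn_of_tendsto (lipschitzWith_angleForce hp) hanti
    (Icc_mem_nhds (by linarith) (by linarith))
    (div_nonneg (sub_nonneg.2 hn) (sub_pos.2 hp).le) ha (hψ.isAngle.mono ha) h.tendsto
    (hψ.tendsto (alpha_pos hp hlam) hρ)

theorem IsPolar.radius_eq_amplitude {ψ : ℝ → ℝ} (hp : 1 < p) (hlam : 0 < lam) (hn : 1 ≤ n)
    (ha : 0 ≤ a) (hρ : 0 < ρ) (hv : IsSolution p lam (damping n) a v)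
    (h : IsPolar p (alpha p lam) a v R ϑ)
    (hψ : IsStart (angleForce p) (alpha p lam) ((n - 1) / (p - 1)) (-quarterPeriod p) ρ a ψ)
    (hat : a < t) : R t = amplitude p ((n - 1) / (p - 1)) a ψ t := by
  have hα := alpha_pos hp hlam
  have hp0 : 0 < p := one_pos.trans hp
  have hlim : Tendsto R (𝓝[>] a) (𝓝 1) := by
    have henergy := (hv.tendsto_energy hp hn ha (alpha p lam)).rpow_const (p := 1 / p)
      (Or.inl one_ne_zero)
    rw [Real.one_rpow] at henergy
    exact henergy.congr' (eventually_mem_nhdsWithin.mono fun s hs =>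
      (h.eq_energy_rpow hp0 hα hs).symm)
  have hquot : ∀ s, a < s →
      HasDerivAt (fun s => R s / amplitude p ((n - 1) / (p - 1)) a ψ s) 0 s := fun s hs =>
    ((h.hasDerivAt_radius hp hlam hv hs).div (hasDerivAt_amplitude hp hα hρ ha hψ hs)
      (amplitude_pos _ _ _ _ _).ne').congr_deriv (by
        rw [decayRate, decayRate, h.eqOn_angle hp hlam hn ha hρ hv hψ hs]
        ring)
  have hone := hlim.div (tendsto_amplitude hp hα hρ ha hψ) one_ne_zero
  rw [div_one] at hone
  have heq := eq_of_hasDerivAt_zero_of_tendsto hquot hone hat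
  rwa [div_eq_one_iff_eq (amplitude_pos _ _ _ _ _).ne'] at heq

end Polar

section Solution

variable {lam n ρ a t : ℝ} {v ϑ : ℝ → ℝ}

theorem IsSolution.eqOn_wave (hp : 1 < p) (hlam : 0 < lam) (hn : 1 ≤ n) (ha : 0 ≤ a) (hρ : 0 < ρ)
    (hϑ : IsStart (angleForce p) (alpha p lam) ((n - 1) / (p - 1)) (-quarterPeriod p) ρ a ϑ)
    (hv : IsSolution p lam (damping n) a v) :
    EqOn v (wave p ((n - 1) / (p - 1)) a ϑ) (Ici a) := by
  intro t (hat : a ≤ t)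
  rcases hat.eq_or_lt with rfl | hat
  · rw [hv.init, wave_init hp hρ.le hϑ]
  obtain ⟨R, ψ, hpolar⟩ := hv.exists_isPolar hp hlam hn ha
  have hψϑ := hpolar.eqOn_angle hp hlam hn ha hρ hv hϑ
  have hamp := hpolar.radius_eq_amplitude hp hlam hn ha hρ hv hϑ hat
  rw [hpolar.eq_mul_pSin t hat, wave, hψϑ hat, hamp]

theorem isSolution_sol {T : ℝ → ℝ} (h : IsSolution p lam T a v) :
    IsSolution p lam T a (sol p lam T a) := by
  have hex : ∃ w, IsSolution p lam T a w := ⟨v, h⟩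
  rw [sol, dif_pos hex]
  exact hex.choose_spec

theorem eqOn_sol_wave (hp : 1 < p) (hlam : 0 < lam) (hn : 1 ≤ n) (ha : 0 ≤ a) (hρ : 0 < ρ)
    (hϑ : IsStart (angleForce p) (alpha p lam) ((n - 1) / (p - 1)) (-quarterPeriod p) ρ a ϑ) :
    EqOn (sol p lam (damping n) a) (wave p ((n - 1) / (p - 1)) a ϑ) (Ici a) :=
  (isSolution_sol (isSolution_wave hp hlam hρ ha hϑ)).eqOn_wave hp hlam hn ha hρ hϑ

theorem deriv_sol (hp : 1 < p) (hlam : 0 < lam) (hn : 1 ≤ n) (ha : 0 ≤ a) (hρ : 0 < ρ)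
    (hϑ : IsStart (angleForce p) (alpha p lam) ((n - 1) / (p - 1)) (-quarterPeriod p) ρ a ϑ)
    (hat : a < t) : deriv (sol p lam (damping n) a) t =
      alpha p lam * amplitude p ((n - 1) / (p - 1)) a ϑ t * pCos p (ϑ t) := by
  rw [← (hasDerivAt_wave hp (alpha_pos hp hlam) hρ ha hϑ hat).deriv]
  exact ((eqOn_sol_wave hp hlam hn ha hρ hϑ).eventuallyEq_of_mem (Ici_mem_nhds hat)).deriv_eq

end Solution

/-! ### The first critical point -/

/-- The angle `ϑ` leaves `-π_p/2` at time `a` and reaches `π_p/2` at time `b`; these are the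
angles at which the solution has its initial minimum and its first maximum. -/
structure IsRise (p α K ρ a b : ℝ) (ϑ : ℝ → ℝ) : Prop where
  radius_pos : 0 < ρ
  isStart : IsStart (angleForce p) α K (-quarterPeriod p) ρ a ϑ
  isHit : IsHit (quarterPeriod p) a b ϑ

theorem exists_isRise {α K : ℝ} (hp : 1 < p) (hα : 0 < α) (hK : 0 ≤ K) :
    ∃ (ρ : ℝ) (b : ℝ → ℝ) (Θ : ℝ → ℝ → ℝ),
      AntitoneOn (angleForce p) (Icc (-quarterPeriod p) (-quarterPeriod p + ρ)) ∧
        ∀ a, 0 ≤ a → IsRise p α K ρ a (b a) (Θ a) := by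
  obtain ⟨ρ, hρ, hanti⟩ := exists_antitoneOn_angleForce hp
  replace hanti := hanti.mono (Icc_subset_Icc_left (sub_le_self _ hρ.le))
  choose! Θ hΘ using fun a (ha : 0 ≤ a) => exists_isStart (lipschitzWith_angleForce hp)
    (abs_angleForce_le_one hp) (angleForce_neg_quarterPeriod hp) hanti hα hρ hK ha
  choose! b hb using fun a (ha : 0 ≤ a) => exists_isHit (abs_angleForce_le_one hp)
    (angleForce_quarterPeriod hp) hα hK ((hΘ a ha).isAngle.mono ha) ((hΘ a ha).tendsto hα hρ)
    (neg_lt_self (quarterPeriod_pos hp))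
  exact ⟨ρ, b, Θ, hanti, fun a ha => ⟨hρ, hΘ a ha, hb a ha⟩⟩

section Rise

variable {α K ρ a b t : ℝ} {ϑ : ℝ → ℝ}

theorem IsRise.pCos_pos (hp : 1 < p) (hα : 0 < α) (ha : 0 ≤ a) (h : IsRise p α K ρ a b ϑ)
    (ht : t ∈ Ioo a b) : 0 < pCos p (ϑ t) :=
  PModel.pCos_pos hp ⟨h.isStart.gt hα h.radius_pos (angleForce_neg_quarterPeriod hp) ha ht.1,
    h.isHit.before t ht.1 ht.2⟩

theorem IsRise.amplitude_lt_one (hp : 1 < p) (hα : 0 < α) (hK : 0 < K) (ha : 0 ≤ a)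
    (h : IsRise p α K ρ a b ϑ) : amplitude p K a ϑ b < 1 := by
  have hpos : 0 < ∫ s in a..b, decayRate p ϑ s := by
    refine intervalIntegral.intervalIntegral_pos_of_pos_on
      (intervalIntegrable_decayRate hp hα h.radius_pos ha h.isStart h.isHit.lt.le)
      (fun t ht => ?_) h.isHit.lt
    exact div_pos (Real.rpow_pos_of_pos (abs_pos.2 (h.pCos_pos hp hα ha ht).ne') p)
      (ha.trans_lt ht.1)
  rw [amplitude, Real.exp_lt_one_iff, neg_mul]
  exact neg_neg_of_pos (mul_pos hK hpos)

theorem IsRise.exp_neg_le_amplitude (hp : 1 < p) (hα : 0 < α) (hK : 0 ≤ K) (ha : 0 < a)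
    (h : IsRise p α K ρ a b ϑ) : exp (-K * ((b - a) / a)) ≤ amplitude p K a ϑ b := by
  have hle : ∫ s in a..b, decayRate p ϑ s ≤ ∫ _ in a..b, 1 / a := by
    refine intervalIntegral.integral_mono_on h.isHit.lt.le
      (intervalIntegrable_decayRate hp hα h.radius_pos ha.le h.isStart h.isHit.lt.le)
      intervalIntegrable_const fun t ht => ?_
    exact div_le_div₀ zero_le_one (abs_pCos_rpow_le_one (one_pos.trans hp) _) ha ht.1
  rw [intervalIntegral.integral_const, smul_eq_mul, mul_one_div] at hle
  rw [amplitude, Real.exp_le_exp, neg_mul, neg_mul, neg_le_neg_iff]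
  exact mul_le_mul_of_nonneg_left hle hK

theorem IsRise.mul_sub_eq (hp : 1 < p) (hα : 0 < α) (ha : 0 ≤ a) (h : IsRise p α 0 ρ a b ϑ) :
    α * (b - a) = piP p := by
  rw [h.isHit.mul_sub_eq hα h.radius_pos ha h.isStart, piP_eq_two_mul_quarterPeriod hp]
  ring

theorem IsRise.piP_lt_mul_sub (hp : 1 < p) (hα : 0 < α) (hK : 0 < K) (ha : 0 ≤ a)
    (h : IsRise p α K ρ a b ϑ) : piP p < α * (b - a) := by
  have hlt := h.isHit.sub_lt_mul_sub (lipschitzWith_angleForce hp)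
    (angleForce_neg_quarterPeriod hp) (hasDerivAt_forcePrimitive hp)
    (forcePrimitive_neg_quarterPeriod p) (forcePrimitive_quarterPeriod hp)
    (fun θ hθ => forcePrimitive_neg_of_mem hp hθ) hα h.radius_pos hK ha h.isStart
  rwa [sub_neg_eq_add, ← two_mul, ← piP_eq_two_mul_quarterPeriod hp] at hlt

theorem IsRise.mul_sub_le_piP (hp : 1 < p) (hK : 0 ≤ K) (ha : 0 < a)
    (h : IsRise p α K ρ a b ϑ) : (α - K / a) * (b - a) ≤ piP p := by
  have hle := h.isStart.isAngle.mul_sub_le (abs_angleForce_le_one hp) hK ha ha h.isHit.lt.le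
  rwa [h.isHit.eq, h.isStart.init h.radius_pos.le, sub_neg_eq_add, ← two_mul,
    ← piP_eq_two_mul_quarterPeriod hp] at hle

end Rise

section FirstCritical

variable {lam n ρ a b : ℝ} {ϑ : ℝ → ℝ}

theorem isLeast_critAfter (hp : 1 < p) (hlam : 0 < lam) (hn : 1 ≤ n) (ha : 0 ≤ a)
    (h : IsRise p (alpha p lam) ((n - 1) / (p - 1)) ρ a b ϑ) :
    IsLeast (critAfter p lam (damping n) a) b := by
  have hα := alpha_pos hp hlam
  have hderiv := fun t => deriv_sol (t := t) hp hlam hn ha h.radius_pos h.isStart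
  refine ⟨⟨h.isHit.lt, ?_⟩, fun t ⟨hat, ht⟩ => not_lt.1 fun htb => ?_⟩
  · rw [hderiv b h.isHit.lt, h.isHit.eq, pCos_quarterPeriod hp, mul_zero]
  · rw [hderiv t hat] at ht
    exact (mul_pos (mul_pos hα (amplitude_pos _ _ _ _ _)) (h.pCos_pos hp hα ha ⟨hat, htb⟩)).ne' ht

theorem firstCrit_eq (hp : 1 < p) (hlam : 0 < lam) (hn : 1 ≤ n) (ha : 0 ≤ a)
    (h : IsRise p (alpha p lam) ((n - 1) / (p - 1)) ρ a b ϑ) :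
    firstCrit p lam (damping n) a = b :=
  (isLeast_critAfter hp hlam hn ha h).csInf_eq

theorem delta_eq (hp : 1 < p) (hlam : 0 < lam) (hn : 1 ≤ n) (ha : 0 ≤ a)
    (h : IsRise p (alpha p lam) ((n - 1) / (p - 1)) ρ a b ϑ) :
    delta p lam (damping n) a = b - a := by
  rw [delta, firstCrit_eq hp hlam hn ha h]

theorem firstMax_eq (hp : 1 < p) (hlam : 0 < lam) (hn : 1 ≤ n) (ha : 0 ≤ a)
    (h : IsRise p (alpha p lam) ((n - 1) / (p - 1)) ρ a b ϑ) :
    firstMax p lam (damping n) a = amplitude p ((n - 1) / (p - 1)) a ϑ b := by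
  rw [firstMax, firstCrit_eq hp hlam hn ha h,
    eqOn_sol_wave hp hlam hn ha h.radius_pos h.isStart h.isHit.lt.le, wave, h.isHit.eq,
    pSin_quarterPeriod hp, mul_one]

theorem wellDefined_damping (hp : 1 < p) (hlam : 0 < lam) (hn : 1 ≤ n) :
    WellDefined p lam (damping n) := by
  obtain ⟨ρ, b, Θ, -, h⟩ := exists_isRise hp (alpha_pos hp hlam)
    (div_nonneg (sub_nonneg.2 hn) (sub_pos.2 hp).le)
  intro a ha
  have hsol := isSolution_wave hp hlam (h a ha).radius_pos ha (h a ha).isStart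
  refine ⟨isSolution_sol hsol, fun v hv => ?_, ?_⟩
  · exact (hv.eqOn_wave hp hlam hn ha (h a ha).radius_pos (h a ha).isStart).trans
      (eqOn_sol_wave hp hlam hn ha (h a ha).radius_pos (h a ha).isStart).symm
  · rw [firstCrit_eq hp hlam hn ha (h a ha)]
    exact isLeast_critAfter hp hlam hn ha (h a ha)

theorem damping_one : damping 1 = fun _ => 0 := by
  funext t
  simp [damping]

theorem delta_damping_one (hp : 1 < p) (hlam : 0 < lam) (ha : 0 ≤ a) :
    delta p lam (damping 1) a = piP p / alpha p lam := by
  have hα := alpha_pos hp hlam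
  have hK : (1 - 1) / (p - 1) = 0 := by rw [sub_self, zero_div]
  obtain ⟨ρ, b, Θ, -, h⟩ := exists_isRise hp hα le_rfl
  rw [delta_eq hp hlam le_rfl ha (hK.symm ▸ h a ha), ← (h a ha).mul_sub_eq hp hα ha,
    mul_div_cancel_left₀ _ hα.ne']

theorem continuousOn_delta_damping (hp : 1 < p) (hlam : 0 < lam) (hn : 1 ≤ n) :
    ContinuousOn (delta p lam (damping n)) (Ici 0) := by
  have hα := alpha_pos hp hlam
  have hK : 0 ≤ (n - 1) / (p - 1) := div_nonneg (sub_nonneg.2 hn) (sub_pos.2 hp).le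
  obtain ⟨ρ, b, Θ, hanti, h⟩ := exists_isRise hp hα hK
  have hb : ContinuousOn b (Ici 0) :=
    continuousOn_hit (lipschitzWith_angleForce hp) hanti hα (h 0 le_rfl).radius_pos hK
      (fun a ha => (h a ha).isStart) fun a ha => (h a ha).isHit
  exact (hb.sub continuousOn_id).congr fun a ha => delta_eq hp hlam hn ha (h a ha)

theorem lt_delta_damping (hp : 1 < p) (hlam : 0 < lam) (hn : 1 < n) (ha : 0 ≤ a) :
    piP p / alpha p lam < delta p lam (damping n) a := by
  have hα := alpha_pos hp hlam
  have hK : 0 < (n - 1) / (p - 1) := div_pos (sub_pos.2 hn) (sub_pos.2 hp)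
  obtain ⟨ρ, b, Θ, -, h⟩ := exists_isRise hp hα hK.le
  rw [delta_eq hp hlam hn.le ha (h a ha), div_lt_iff₀' hα]
  exact (h a ha).piP_lt_mul_sub hp hα hK ha

theorem delta_damping_le (hp : 1 < p) (hlam : 0 < lam) (hn : 1 ≤ n) (ha : 0 < a)
    (hlt : (n - 1) / (p - 1) / a < alpha p lam) :
    delta p lam (damping n) a ≤ piP p / (alpha p lam - (n - 1) / (p - 1) / a) := by
  have hK : 0 ≤ (n - 1) / (p - 1) := div_nonneg (sub_nonneg.2 hn) (sub_pos.2 hp).le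
  obtain ⟨ρ, b, Θ, -, h⟩ := exists_isRise hp (alpha_pos hp hlam) hK
  rw [delta_eq hp hlam hn ha.le (h a ha.le), le_div_iff₀' (sub_pos.2 hlt)]
  exact (h a ha.le).mul_sub_le_piP hp hK ha

theorem tendsto_delta_damping (hp : 1 < p) (hlam : 0 < lam) (hn : 1 < n) :
    Tendsto (delta p lam (damping n)) atTop (𝓝 (piP p / alpha p lam)) := by
  have hα := alpha_pos hp hlam
  have hK : Tendsto (fun a : ℝ => (n - 1) / (p - 1) / a) atTop (𝓝 0) :=
    tendsto_const_nhds.div_atTop tendsto_id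
  have hupper : Tendsto (fun a : ℝ => piP p / (alpha p lam - (n - 1) / (p - 1) / a)) atTop
      (𝓝 (piP p / alpha p lam)) := by
    have hdenom := hK.const_sub (alpha p lam)
    rw [sub_zero] at hdenom
    exact tendsto_const_nhds.div hdenom hα.ne'
  refine tendsto_of_tendsto_of_tendsto_of_le_of_le' tendsto_const_nhds hupper ?_ ?_
  · filter_upwards [eventually_ge_atTop 0] with a ha using (lt_delta_damping hp hlam hn ha).le
  · filter_upwards [eventually_gt_atTop 0, hK.eventually_lt_const hα] with a ha hlt
      using delta_damping_le hp hlam hn.le ha hlt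

theorem firstMax_damping_lt_one (hp : 1 < p) (hlam : 0 < lam) (hn : 1 < n) (ha : 0 ≤ a) :
    firstMax p lam (damping n) a < 1 := by
  have hα := alpha_pos hp hlam
  have hK : 0 < (n - 1) / (p - 1) := div_pos (sub_pos.2 hn) (sub_pos.2 hp)
  obtain ⟨ρ, b, Θ, -, h⟩ := exists_isRise hp hα hK.le
  rw [firstMax_eq hp hlam hn.le ha (h a ha)]
  exact (h a ha).amplitude_lt_one hp hα hK ha

theorem exp_neg_le_firstMax_damping (hp : 1 < p) (hlam : 0 < lam) (hn : 1 ≤ n) (ha : 0 < a) :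
    exp (-((n - 1) / (p - 1)) * (delta p lam (damping n) a / a)) ≤
      firstMax p lam (damping n) a := by
  have hα := alpha_pos hp hlam
  have hK : 0 ≤ (n - 1) / (p - 1) := div_nonneg (sub_nonneg.2 hn) (sub_pos.2 hp).le
  obtain ⟨ρ, b, Θ, -, h⟩ := exists_isRise hp hα hK
  rw [delta_eq hp hlam hn ha.le (h a ha.le), firstMax_eq hp hlam hn ha.le (h a ha.le)]
  exact (h a ha.le).exp_neg_le_amplitude hp hα hK ha

theorem tendsto_firstMax_damping (hp : 1 < p) (hlam : 0 < lam) (hn : 1 < n) :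
    Tendsto (firstMax p lam (damping n)) atTop (𝓝 1) := by
  have hlower := (((tendsto_delta_damping hp hlam hn).div_atTop tendsto_id).const_mul
    (-((n - 1) / (p - 1)))).rexp
  rw [mul_zero, exp_zero] at hlower
  refine tendsto_of_tendsto_of_tendsto_of_le_of_le' hlower tendsto_const_nhds ?_ ?_
  · filter_upwards [eventually_gt_atTop 0] with a ha
      using exp_neg_le_firstMax_damping hp hlam hn.le ha
  · filter_upwards [eventually_ge_atTop 0] with a ha
      using (firstMax_damping_lt_one hp hlam hn ha).le

end FirstCritical

section Extension

variable {lam : ℝ} {T : ℝ → ℝ}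

theorem deltaExt_pos (htop : 0 < piP p / alpha p lam) (hpos : ∀ a, 0 ≤ a → 0 < delta p lam T a)
    (x : ℝ≥0∞) : 0 < deltaExt p lam T x := by
  rw [deltaExt]
  split_ifs
  · exact htop
  · exact hpos _ ENNReal.toReal_nonneg

theorem continuousAt_deltaExt_top
    (h : Tendsto (delta p lam T) atTop (𝓝 (piP p / alpha p lam))) :
    ContinuousAt (deltaExt p lam T) ⊤ := by
  rw [ContinuousAt, deltaExt, if_pos rfl]
  intro s hs
  rw [mem_map]
  obtain ⟨A, hA⟩ := eventually_atTop.1 (h hs)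
  filter_upwards [Ioi_mem_nhds (ENNReal.ofReal_lt_top : ENNReal.ofReal A < ⊤)] with y hy
  rw [mem_preimage, deltaExt]
  split_ifs with hy'
  · exact mem_of_mem_nhds hs
  · exact hA _ ((ENNReal.ofReal_le_iff_le_toReal hy').1 (le_of_lt hy))

theorem continuous_deltaExt (hcont : ContinuousOn (delta p lam T) (Ici 0))
    (hlim : Tendsto (delta p lam T) atTop (𝓝 (piP p / alpha p lam))) :
    Continuous (deltaExt p lam T) := by
  refine continuous_iff_continuousAt.2 fun x => ?_
  rcases eq_or_ne x ⊤ with rfl | hx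
  · exact continuousAt_deltaExt_top hlim
  · have htoReal : Tendsto ENNReal.toReal (𝓝 x) (𝓝[Ici 0] x.toReal) :=
      tendsto_nhdsWithin_iff.2 ⟨ENNReal.tendsto_toReal hx,
        .of_forall fun _ => ENNReal.toReal_nonneg⟩
    have hcomp : ContinuousAt (fun y : ℝ≥0∞ => delta p lam T y.toReal) x :=
      (hcont x.toReal ENNReal.toReal_nonneg).tendsto.comp htoReal
    refine hcomp.congr ?_
    filter_upwards [isOpen_ne.mem_nhds hx] with y hy
    rw [deltaExt, if_neg hy]

end Extension

end PModel

end

theorem mainTheorem6 (p lam n : ℝ) (hp : 1 < p) (hlam : 0 < lam) (hn : 1 < n) :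
    -- the objects are well defined, both for `T = -(n-1)/t` and for `T = 0`
    PModel.WellDefined p lam (PModel.damping n) ∧
    PModel.WellDefined p lam (fun _ => 0) ∧
    -- `π_p / α` is the value of `δ` in the undamped case
    (∀ a, 0 ≤ a → PModel.delta p lam (fun _ => 0) a = PModel.piP p / PModel.alpha p lam) ∧
    -- `δ` is continuous on `[0, ∞)`, above `π_p / α`, and tends to it
    ContinuousOn (PModel.delta p lam (PModel.damping n)) (Set.Ici 0) ∧
    (∀ a, 0 ≤ a →
      PModel.piP p / PModel.alpha p lam < PModel.delta p lam (PModel.damping n) a) ∧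
    Filter.Tendsto (PModel.delta p lam (PModel.damping n)) Filter.atTop
      (nhds (PModel.piP p / PModel.alpha p lam)) ∧
    -- the first maximum
    (∀ a, 0 ≤ a → PModel.firstMax p lam (PModel.damping n) a < 1) ∧
    Filter.Tendsto (PModel.firstMax p lam (PModel.damping n)) Filter.atTop (nhds 1) ∧
    -- the extension of `δ` to `[0, ∞]` is positive and continuous
    (∀ a, 0 < PModel.deltaExt p lam (PModel.damping n) a) ∧
    Continuous (PModel.deltaExt p lam (PModel.damping n)) := by
  open PModel in
  have hpi : 0 < piP p / alpha p lam :=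
    div_pos (piP_pos hp) (alpha_pos hp hlam)
  have hcont := continuousOn_delta_damping hp hlam hn.le
  have hlt := fun a => lt_delta_damping (a := a) hp hlam hn
  have hlim := tendsto_delta_damping hp hlam hn
  refine ⟨wellDefined_damping hp hlam hn.le, ?_, fun a ha => ?_, hcont, hlt, hlim,
    fun a => firstMax_damping_lt_one hp hlam hn, tendsto_firstMax_damping hp hlam hn,
    deltaExt_pos hpi fun a ha => hpi.trans (hlt a ha), continuous_deltaExt hcont hlim⟩
  · exact damping_one ▸ wellDefined_damping hp hlam le_rfl
  · exact damping_one ▸ delta_damping_one hp hlam ha
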